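/- Let $k$ be a (commutative) field and let $\mathcal{A}$ be an essentially small additive category which is $k$-trivial, i.e. for all objects $x,y$ of $\mathcal{A}$ the abelian group $\mathcal{A}(x,y)$ is finite, of order invertible in $k$. Let $\mathbf{Rep}(\mathcal{A})$ be the category of additive functors from $\mathcal{A}$ to abelian groups, and $\mathcal{F}(\mathcal{A};k)$ the category of all functors from $\mathcal{A}$ to $k$-vector spaces. An object of $\mathbf{Rep}(\mathcal{A})$ is called finite if it is noetherian and artinian; $\ell(A)$ denotes the length of such an object. For $A$ in $\mathbf{Rep}(\mathcal{A})$, let $k[A]\in\mathcal{F}(\mathcal{A};k)$ be the functor $a\mapsto k[A(a)]$ (the $k$-vector space with basis $A(a)$), and let $Q_A$ be the cokernel of the morphism $\bigoplus_{B\subsetneq A}k[B]\to k[A]$ induced by the inclusions of the proper subobjects $B$ of $A$; the group $\mathrm{Aut}(A)$ acts on $Q_A$. For a $k[\mathrm{Aut}(A)]$-module $M$, let $Q_{A,M}\in\mathcal{F}(\mathcal{A};k)$ be the functor $a\mapsto (M\otimes_k Q_A(a))_{\mathrm{Aut}(A)}$ (coinvariants of the diagonal action). Let $A$ and $B$ be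 finite objects of $\mathbf{Rep}(\mathcal{A})$ such that $\ell(A)\le\ell(B)$, let $M$ be a $k[\mathrm{Aut}(A)]$-module and $N$ a $k[\mathrm{Aut}(B)]$-module. 1. If $A$ and $B$ are not isomorphic, then $\mathrm{Ext}^n_{\mathcal{F}(\mathcal{A};k)}(Q_{A,M},Q_{B,N})=0$ for every $n\ge 0$. 2. If $A=B$, the functor $Q_{A,-}$ from $k[\mathrm{Aut}(A)]$-modules to $\mathcal{F}(\mathcal{A};k)$ is exact, and the natural morphism $$\mathrm{Ext}^n_{k[\mathrm{Aut}(A)]}(M,N)\longrightarrow\mathrm{Ext}^n_{\mathcal{F}(\mathcal{A};k)}(Q_{A,M},Q_{A,N})$$ which it induces is an isomorphism for every $n\ge 0$. -/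

import Mathlib

open CategoryTheory CategoryTheory.Limits

universe w v u

noncomputable section

namespace GenericRep

variable {𝒜 : Type u} [Category.{v} 𝒜] [Preadditive 𝒜]

/-! ### `k`-trivial additive categories -/

/-- A preadditive category is `k`-trivial if each of its groups of morphisms is finite, of order
invertible in `k`. -/
structure IsKTrivial (k : Type w) [Field k] (𝒜 : Type u) [Category.{v} 𝒜] [Preadditive 𝒜] :
    Prop where
  finite_hom (x y : 𝒜) : Finite (x ⟶ y)
  isUnit_card_hom (x y : 𝒜) : IsUnit ((Nat.card (x ⟶ y) : ℕ) : k)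

/-! ### Finite objects and length -/

/-- An object is finite (of finite length) if it is both noetherian and artinian. -/
structure IsFiniteObject {C : Type*} [Category* C] (X : C) : Prop where
  isArtinian : IsArtinianObject X
  isNoetherian : IsNoetherianObject X

/-- The length of an object: the supremum of the lengths `n` of chains `X₀ < X₁ < ⋯ < Xₙ` of
subobjects. -/
def objLength {C : Type*} [Category* C] (X : C) : WithBot ℕ∞ :=
  Order.krullDim (Subobject X)

/-! ### The two categories of functors -/

/-- The category of additive functors from `𝒜` to abelian groups. -/
abbrev AddRep (𝒜 : Type u) [Category.{v} 𝒜] [Preadditive 𝒜] :=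
  𝒜 ⥤+ AddCommGrpCat.{w}

/-- The category of all functors from `𝒜` to `k`-vector spaces. -/
abbrev FunRep (k : Type w) [Field k] (𝒜 : Type u) [Category.{v} 𝒜] :=
  𝒜 ⥤ ModuleCat.{w} k

variable (k : Type w) [Field k]

/-- The linearisation functor `A ↦ k[A]`. -/
def linearization : AddRep.{w} 𝒜 ⥤ FunRep k 𝒜 :=
  AdditiveFunctor.forget 𝒜 AddCommGrpCat.{w} ⋙
    (Functor.whiskeringRight 𝒜 _ _).obj (forget AddCommGrpCat.{w} ⋙ ModuleCat.free k)

/-! ### The functor `Q_A` -/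

variable (A : AddRep.{w} 𝒜)

/-- The value at `a` of the image of the canonical morphism `⨁_{B ⊊ A} k[B] ⟶ k[A]`. -/
def properPart (a : 𝒜) : Submodule k (((linearization k).obj A).obj a) :=
  ⨆ B : {B : Subobject A // B ≠ ⊤},
    LinearMap.range (((linearization k).map B.1.arrow).app a).hom

variable {A} in
lemma properPart_le_comap_map {a b : 𝒜} (f : a ⟶ b) :
    properPart k A a ≤
      (properPart k A b).comap (((linearization k).obj A).map f).hom := by
  refine iSup_le fun B => ?_
  rintro _ ⟨x, rfl⟩
  have h := congr($(((linearization k).map B.1.arrow).naturality f) x)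
  exact (le_iSup (fun B : {B : Subobject A // B ≠ ⊤} =>
    LinearMap.range (((linearization k).map B.1.arrow).app b).hom) B) ⟨_, h⟩

variable {A} in
lemma properPart_le_comap_aut (g : Aut A) (a : 𝒜) :
    properPart k A a ≤
      (properPart k A a).comap (((linearization k).map g.hom).app a).hom := by
  refine iSup_le fun B => ?_
  rintro _ ⟨x, rfl⟩
  have hg : IsIso g.hom := Iso.isIso_hom (show A ≅ A from g)
  let C : Subobject A := Subobject.mk (B.1.arrow ≫ g.hom)
  have hC : C ≠ ⊤ := by
    intro h
    have h1 : IsIso (B.1.arrow ≫ g.hom) := (Subobject.isIso_iff_mk_eq_top _).2 h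
    have h2 : IsIso B.1.arrow := IsIso.of_isIso_comp_right _ g.hom
    exact B.2 ((Subobject.isIso_arrow_iff_eq_top B.1).1 h2)
  refine (le_iSup (fun B : {B : Subobject A // B ≠ ⊤} =>
    LinearMap.range (((linearization k).map B.1.arrow).app a).hom) ⟨C, hC⟩) ?_
  refine ⟨(((linearization k).map
    (Subobject.underlyingIso (B.1.arrow ≫ g.hom)).inv).app a).hom x, ?_⟩
  have e : (linearization k).map (Subobject.underlyingIso (B.1.arrow ≫ g.hom)).inv ≫
      (linearization k).map C.arrow =
      (linearization k).map B.1.arrow ≫ (linearization k).map g.hom := by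
    rw [← Functor.map_comp, ← Functor.map_comp, Subobject.underlyingIso_arrow]
  exact congr(($(e).app a).hom x)

/-- The action of `Aut A` on the quotient `Q_A(a)` of `k[A(a)]`. -/
def quotientAction (a : 𝒜) :
    Representation k (Aut A) (((linearization k).obj A).obj a ⧸ properPart k A a) where
  toFun g := Submodule.mapQ _ _ (((linearization k).map g.hom).app a).hom
    (properPart_le_comap_aut k g a)
  map_one' := by
    refine Submodule.linearMap_qext _ (LinearMap.ext fun x => ?_)
    exact congrArg (properPart k A a).mkQ
      congr((($((linearization k).map_id A)).app a).hom x)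
  map_mul' g h := by
    refine Submodule.linearMap_qext _ (LinearMap.ext fun x => ?_)
    exact congrArg (properPart k A a).mkQ
      congr((($((linearization k).map_comp h.hom g.hom)).app a).hom x)

/-- The functor `Q_A`, the cokernel of the canonical morphism `⨁_{B ⊊ A} k[B] ⟶ k[A]`, together
with the action of `Aut A`: a functor from `𝒜` to `k`-linear representations of `Aut A`. -/
def QA : 𝒜 ⥤ Rep.{w} k (Aut A) where
  obj a := Rep.of (quotientAction k A a)
  map {a b} f := Rep.ofHom
    { toLinearMap := Submodule.mapQ _ _ (((linearization k).obj A).map f).hom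
        (properPart_le_comap_map k f)
      isIntertwining' := fun g => by
        refine Submodule.linearMap_qext _ (LinearMap.ext fun x => ?_)
        exact congrArg (properPart k A b).mkQ
          congr($(((linearization k).map g.hom).naturality f) x).symm }
  map_id a := by
    ext x
    exact congrArg (properPart k A a).mkQ congr($(((linearization k).obj A).map_id a) x)
  map_comp {a b c} f g := by
    ext x
    exact congrArg (properPart k A c).mkQ congr($(((linearization k).obj A).map_comp f g) x)

open scoped MonoidAlgebra

/-- The functor `Q_{A,-}`, sending a `k[Aut A]`-module `M` to the functor
`a ↦ (M ⊗ Q_A(a))_{Aut A}`, the coinvariants of the diagonal action of `Aut A`. -/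
def QFunctor : ModuleCat.{w} k[Aut A] ⥤ FunRep k 𝒜 :=
  Rep.ofModuleMonoidAlgebra ⋙ Rep.coinvariantsTensor k (Aut A) ⋙
    (Functor.whiskeringLeft 𝒜 _ _).obj (QA k A)

instance : (Rep.ofModuleMonoidAlgebra (k := k) (G := Aut A)).Additive where

instance : (QFunctor k A).Additive where
  map_add {M N f g} := by
    ext a : 2
    refine Rep.coinvariantsTensor_hom_ext ?_
    refine LinearMap.ext fun m => LinearMap.ext fun q => ?_
    exact (congrArg (Representation.Coinvariants.mk
      ((Rep.ofModuleMonoidAlgebra.obj N).ρ.tprod ((QA k A).obj a).ρ))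
      (TensorProduct.add_tmul ((Rep.ofModuleMonoidAlgebra.map f).hom m)
        ((Rep.ofModuleMonoidAlgebra.map g).hom m) q)).trans (map_add _ _ _)

/-! ### `Ext` groups

Mathlib's `Ext` groups, taken in a universe in which they always exist. -/

universe v₁ v₂ u₁ u₂

/-- The group `Extⁿ(X, Y)` in an abelian category. -/
abbrev ExtGroup {C : Type u₁} [Category.{v₁} C] [Abelian C] (X Y : C) (n : ℕ) :
    Type (max u₁ v₁) :=
  letI : HasExt.{max u₁ v₁} C := HasExt.standard C
  Abelian.Ext.{max u₁ v₁} X Y n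

/-- The morphism `Extⁿ(X, Y) ⟶ Extⁿ(F X, F Y)` induced by an exact functor `F`. -/
abbrev mapExtGroup {C : Type u₁} [Category.{v₁} C] [Abelian C]
    {D : Type u₂} [Category.{v₂} D] [Abelian D] (F : C ⥤ D) [F.Additive]
    [PreservesFiniteLimits F] [PreservesFiniteColimits F] (X Y : C) (n : ℕ) :
    ExtGroup X Y n →+ ExtGroup (F.obj X) (F.obj Y) n :=
  letI : HasExt.{max u₁ v₁} C := HasExt.standard C
  letI : HasExt.{max u₂ v₂} D := HasExt.standard D
  F.mapExtAddHom X Y n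

end GenericRep

end

/-! A finite object `A` is generated by a single element `ξ` of some `A(x)`. The generating elements
of `A(a)` index a basis of `Q_A(a)` (`properPart_eq`), and `Aut A` acts freely on them
(`IsGenerating.aut_eq`). As `A(a)` is finite, `Q_{A,V}(a)` is thus the space of equivariant
`V`-valued functions on the generating elements. The maps `coeff` are these coordinates, and
morphisms of `𝒜` act by summation over fibres (`coeff_map`). Exactness of `Q_{A,-}` can be read off
from this description.

Morphisms are controlled by relations. If the image of `[v]` in `Q_{B,W}` has a nonzero coefficient
at `β`, every relation on `v` holds for `β` (`map_eq_zero_of_coeff_ne_zero`), so the subobject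
generated by `v` maps onto `B`. Comparing lengths, `v` generates `A`, and there is an isomorphism `A
≅ B` taking `v` to `β` (`exists_iso_of_relations`). This gives the case `n = 0`: vanishing for
non-isomorphic objects, full faithfulness for `A = B`.

In positive degrees, the core is that `Q_{A,L}` with `L` free has no higher extensions by `Q_{B,J}`
with `J` injective (`FreeBasis.subsingleton_ext`). The functor `Q_{A,L}` is the quotient of the
linearisation of copies of `A` by that of the non-generating elements, and the latter has a Čech
resolution coming from a covering by additive subfunctors. The Čech terms have no nonzero morphism
to `Q_{B,J}` (`lin_cech_hom_eq_zero`), and all terms are linearisations of disjoint unions of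
product-preserving functors, which are acyclic for `Q_{B,J}` (`subsingleton_ext_lin_QRep`).

That acyclicity comes from a second Čech resolution, of `k[X]` by a cover of `X` by representables.
Cocycles with values in `F` are coboundaries as soon as natural families in `F` can be averaged
naturally (`Mean.exists_comp_eq`). For `F = Q_{B,J}` the average is taken coefficient by
coefficient, as a generalised limit along a filter; injectivity of `J` supplies the limit
(`nonempty_genLim`), and the shear in `meanTerm_restrict` supplies naturality.

Shifting dimensions in both variables then gives the first claim. For the second, fullness handles
degree one, so the objects `Q_{A,J}` are acyclic for the image of `Q_{A,-}` and
`mapExtAddHom_bijective` applies. -/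

noncomputable section

namespace GenericRep

open CategoryTheory CategoryTheory.Limits

section

/-! ### Homological algebra: dimension shifting for `Ext` -/

section ExtVanishing

universe t v₁ u₁ t' v₂ u₂

open Abelian

variable {C : Type u₁} [Category.{v₁} C] [Abelian C] [HasExt.{t} C]

lemma subsingleton_ext_of_iso {X X' : C} (e : X ≅ X') (F : C) (n : ℕ)
    (h : Subsingleton (Ext X F n)) : Subsingleton (Ext X' F n) := by
  refine subsingleton_of_forall_eq 0 fun x => ?_
  have : x = (Ext.mk₀ e.inv).comp ((Ext.mk₀ e.hom).comp x (zero_add n)) (zero_add n) := by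
    rw [← Ext.comp_assoc_of_second_deg_zero, Ext.mk₀_comp_mk₀, e.inv_hom_id, Ext.mk₀_id_comp]
  rw [this, Subsingleton.elim ((Ext.mk₀ e.hom).comp x (zero_add n)) 0, Ext.comp_zero]

lemma subsingleton_ext_zero_iff (X F : C) :
    Subsingleton (Ext X F 0) ↔ ∀ f : X ⟶ F, f = 0 := by
  let e : Ext X F 0 ≃ (X ⟶ F) := Ext.homEquiv₀
  refine ⟨fun h f => e.symm.injective (Subsingleton.elim _ _), fun h => ?_⟩
  exact e.subsingleton_congr.2 (subsingleton_of_forall_eq 0 h)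

section

variable {S : ShortComplex C} (hS : S.ShortExact) (F : C)

include hS

lemma subsingleton_ext_X₃ (n : ℕ) (h₁ : Subsingleton (Ext S.X₁ F n))
    (h₂ : Subsingleton (Ext S.X₂ F (n + 1))) : Subsingleton (Ext S.X₃ F (n + 1)) := by
  refine subsingleton_of_forall_eq 0 fun x => ?_
  obtain ⟨y, rfl⟩ := Ext.contravariant_sequence_exact₃ hS F x (Subsingleton.elim _ _)
    (add_comm 1 n)
  rw [Subsingleton.elim y 0, Ext.comp_zero]

/-- If every morphism from the subobject extends, then `Ext¹` of the quotient vanishes as soon as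
`Ext¹` of the middle term does. -/
lemma subsingleton_ext_one_X₃ (h : ∀ ψ : S.X₁ ⟶ F, ∃ φ : S.X₂ ⟶ F, S.f ≫ φ = ψ)
    (h₂ : Subsingleton (Ext S.X₂ F 1)) : Subsingleton (Ext S.X₃ F 1) := by
  refine subsingleton_of_forall_eq 0 fun x => ?_
  obtain ⟨y, rfl⟩ := Ext.contravariant_sequence_exact₃ hS F x (Subsingleton.elim _ _)
    (add_comm 1 0)
  obtain ⟨ψ, rfl⟩ := Ext.homEquiv₀.symm.surjective y
  obtain ⟨φ, rfl⟩ := h ψ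
  have : Ext.homEquiv₀.symm (S.f ≫ φ) = (Ext.mk₀ S.f).comp (Ext.mk₀ φ) (zero_add 0) := by
    rw [Ext.mk₀_comp_mk₀]; rfl
  rw [this, ← Ext.comp_assoc (a₁₂ := 1) (a₂₃ := 0) (a := 1) (h₁₂ := rfl) (h₂₃ := rfl)
    (h := rfl), hS.extClass_comp, Ext.zero_comp]

lemma subsingleton_ext_X₁_right (G : C) (n : ℕ) (h₃ : Subsingleton (Ext G S.X₃ n))
    (h₂ : Subsingleton (Ext G S.X₂ (n + 1))) : Subsingleton (Ext G S.X₁ (n + 1)) := by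
  refine subsingleton_of_forall_eq 0 fun x => ?_
  obtain ⟨y, rfl⟩ := Ext.covariant_sequence_exact₁ G hS x (Subsingleton.elim _ _) rfl
  rw [Subsingleton.elim y 0, Ext.zero_comp]

end

/-- Dimension shifting along a resolution `⋯ ⟶ K 1 ⟶ K 0 ⟶ Z` whose complex of morphisms to `F` is
exact. -/
lemma subsingleton_ext_of_resolution {F : C} (n : ℕ) (Z : C) (K : ℕ → C) (ε : K 0 ⟶ Z) [Epi ε]
    (d : ∀ p, K (p + 1) ⟶ K p) (hε : d 0 ≫ ε = 0) (hd : ∀ p, d (p + 1) ≫ d p = 0)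
    (exε : (ShortComplex.mk _ _ hε).Exact) (exd : ∀ p, (ShortComplex.mk _ _ (hd p)).Exact)
    (hF : ∀ p (φ : K (p + 1) ⟶ F), d (p + 1) ≫ φ = 0 → ∃ χ : K p ⟶ F, d p ≫ χ = φ)
    (hE : ∀ p i, p + i ≤ n → Subsingleton (Ext (K p) F (i + 1))) :
    Subsingleton (Ext Z F (n + 1)) := by
  induction n generalizing Z K with
  | zero =>
    have hS : (ShortComplex.mk _ _ (kernel.condition ε)).ShortExact :=
      { exact := ShortComplex.exact_kernel ε }
    have := exε.epi_kernelLift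
    refine subsingleton_ext_one_X₃ hS F (fun ψ => ?_) (hE 0 0 le_rfl)
    -- To extend `ψ` from the kernel of `ε`, pull it back along the epimorphism from `K 1` onto this
    -- kernel; the result is a cocycle, hence a coboundary.
    obtain ⟨χ, hχ⟩ := hF 0 (kernel.lift ε (d 0) hε ≫ ψ) (by
      rw [← Category.assoc, show d (0 + 1) ≫ kernel.lift ε (d 0) hε = 0 by
        rw [← cancel_mono (kernel.ι ε)]; simpa using hd 0, zero_comp])
    refine ⟨χ, ?_⟩
    rw [← cancel_epi (kernel.lift ε (d 0) hε), ← hχ]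
    simp
  | succ n ih =>
    have hS : (ShortComplex.mk _ _ (kernel.condition ε)).ShortExact :=
      { exact := ShortComplex.exact_kernel ε }
    have he : Epi (kernel.lift ε (d 0) hε) := exε.epi_kernelLift
    refine subsingleton_ext_X₃ hS F (n + 1) ?_ (hE 0 (n + 1) (by omega))
    have h0 : d (0 + 1) ≫ kernel.lift ε (d 0) hε = 0 := by
      rw [← cancel_mono (kernel.ι ε)]; simpa using hd 0
    refine ih (kernel ε) (fun p => K (p + 1)) (kernel.lift ε (d 0) hε) (fun p => d (p + 1))
      h0 (fun p => hd (p + 1)) ?_ (fun p => exd (p + 1)) (fun p => hF (p + 1))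
      (fun p i h => hE (p + 1) i (by omega))
    let α : ShortComplex.mk _ _ h0 ⟶ ShortComplex.mk _ _ (hd 0) :=
      { τ₁ := 𝟙 _, τ₂ := 𝟙 _, τ₃ := kernel.ι ε }
    have : Epi α.τ₁ := inferInstanceAs (Epi (𝟙 _))
    have : IsIso α.τ₂ := inferInstanceAs (IsIso (𝟙 _))
    have : Mono α.τ₃ := inferInstanceAs (Mono (kernel.ι ε))
    exact (ShortComplex.exact_iff_of_epi_of_isIso_of_mono α).2 (exd 0)

/-- A fully faithful exact functor sending injective objects to objects that are acyclic for the
image of the functor induces isomorphisms on `Ext`. -/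
lemma mapExtAddHom_bijective {D : Type u₂} [Category.{v₂} D] [Abelian D] [HasExt.{t'} D]
    (F : C ⥤ D) [F.Additive] [PreservesFiniteLimits F] [PreservesFiniteColimits F]
    [F.Full] [F.Faithful] [EnoughInjectives C]
    (h : ∀ (X J : C) [Injective J] (n : ℕ), Subsingleton (Ext (F.obj X) (F.obj J) (n + 1)))
    (X Y : C) (n : ℕ) : Function.Bijective (F.mapExtAddHom X Y n) := by
  induction n generalizing Y with
  | zero =>
    simpa [Ext.mapExactFunctor₀] using
      ⟨Functor.Faithful.map_injective, Functor.Full.map_surjective⟩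
  | succ n hn =>
    let I : InjectivePresentation Y := Classical.arbitrary _
    have hI := I.injective
    let S := ShortComplex.mk _ _ (cokernel.condition I.f)
    have hS : S.ShortExact := { exact := ShortComplex.exact_cokernel I.f }
    have h₁ : Subsingleton (Ext X S.X₂ (n + 1)) := Ext.subsingleton_of_injective _ I.J _
    have h₂ : Subsingleton (Ext (F.obj X) (S.map F).X₂ (n + 1)) := h X I.J n
    -- Compare the covariant long exact sequences of `Y ⟶ I ⟶ I/Y` and of its image; in both, the
    -- `Ext` group of degree `n + 1` into the middle term vanishes.
    exact AddMonoidHom.bijective_of_surjective_of_bijective_of_right_exact _ _ _ _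
      (F.mapExtAddHom X S.X₂ n) (F.mapExtAddHom X S.X₃ n) (F.mapExtAddHom X S.X₁ (n + 1))
      (by ext; simp [Ext.mapExactFunctor_comp, Ext.mapExactFunctor_mk₀]; rfl)
      (by ext; simp [Ext.mapExactFunctor_comp, Ext.mapExactFunctor_extClass]; rfl)
      ((ShortComplex.ab_exact_iff_function_exact _).mp
        (Ext.covariant_sequence_exact₃' X hS n (n + 1) rfl))
      ((ShortComplex.ab_exact_iff_function_exact _).mp
        (Ext.covariant_sequence_exact₃' (F.obj X) (hS.map F) n (n + 1) rfl))
      (hn _).surjective (hn _)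
      (fun x₁ ↦ Ext.covariant_sequence_exact₁ _ hS x₁ (Subsingleton.elim _ _) rfl)
      (fun y₁ ↦ Ext.covariant_sequence_exact₁ _ (hS.map F) y₁ (Subsingleton.elim _ _) rfl)

end ExtVanishing

end

section

open scoped ZeroObject

/-! ### Finiteness of length in modular lattices -/

section Order

variable {α : Type*} [Lattice α] [IsModularLattice α] [BoundedOrder α]

/-- Noetherian induction on the elements below which a rank function exists: a maximal such `x` must
be `⊤`, since modularity lets the rank function pass to any cover `y` of `x`. This bounds the
lengths of chains, so that finite objects have finite length. -/
lemma exists_strictMono_nat [WellFoundedLT α] [WellFoundedGT α] : ∃ f : α → ℕ, StrictMono f := by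
  classical
  let good : Set α := {x | ∃ f : α → ℕ, ∀ a b, a < b → b ≤ x → f a < f b}
  have hne : good.Nonempty :=
    ⟨⊥, fun _ => 0, fun a b hab hb => absurd (hab.trans_le hb) not_lt_bot⟩
  obtain ⟨x, ⟨f, hf⟩, hmax⟩ := WellFounded.has_min (wellFounded_gt (α := α)) good hne
  by_cases hx : x = ⊤
  · subst hx
    exact ⟨f, fun a b h => hf a b h le_top⟩
  obtain ⟨y, hxy, hmin⟩ := WellFounded.has_min (wellFounded_lt (α := α)) (Set.Ioi x)
    ⟨⊤, lt_top_iff_ne_top.2 hx⟩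
  -- Below `y`, the length of `z` is that of `z ⊓ x` plus that of the image of `z` in the simple
  -- interval `[x, y]`.
  refine absurd hxy (hmax y ⟨fun z => f (z ⊓ x) + if z ≤ x then 0 else 1, fun a b hab hb => ?_⟩)
  have key : ∀ c, c ≤ y → ¬ c ≤ x → c ⊔ x = y := fun c hc hcx => by
    by_contra hne
    exact hmin (c ⊔ x) (lt_of_le_of_ne le_sup_right fun h => hcx (h ▸ le_sup_left))
      (lt_of_le_of_ne (sup_le hc (le_of_lt hxy)) hne)
  dsimp only
  rcases (inf_le_inf_right x hab.le).lt_or_eq with h | h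
  · have h1 := hf _ _ h inf_le_right
    have h2 : (if a ≤ x then 0 else 1) ≤ if b ≤ x then 0 else 1 := by
      split_ifs with h3 h4 h4
      · exact le_rfl
      · exact Nat.zero_le _
      · exact absurd (hab.le.trans h4) h3
      · exact le_rfl
    omega
  · have h1 : a ⊔ x < b ⊔ x := sup_lt_sup_of_lt_of_inf_le_inf hab h.ge
    have hbx : ¬ b ≤ x := fun hbx => by
      rw [sup_eq_right.2 hbx, sup_eq_right.2 (hab.le.trans hbx)] at h1
      exact lt_irrefl _ h1
    have hax : a ≤ x := by
      by_contra hax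
      rw [key a (hab.le.trans hb) hax, key b hb hbx] at h1
      exact lt_irrefl _ h1
    rw [h, if_pos hax, if_neg hbx]
    exact Nat.lt_succ_self _

lemma krullDim_ne_top [WellFoundedLT α] [WellFoundedGT α] : Order.krullDim α ≠ ⊤ := by
  obtain ⟨f, hf⟩ := exists_strictMono_nat (α := α)
  have h : StrictMono fun x => (⟨f x, Nat.lt_succ_of_le (hf.monotone le_top)⟩ : Fin (f ⊤ + 1)) :=
    fun a b hab => hf hab
  refine ne_top_of_le_ne_top ?_ (Order.krullDim_le_of_strictMono _ h)
  refine ne_top_of_le_ne_top (b := ((f ⊤ : ℕ) : WithBot ℕ∞)) (fun h =>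
    ENat.natCast_ne_top (f ⊤) (WithBot.coe_injective h)) (iSup_le fun p => ?_)
  have := p.length_lt_card
  rw [Fintype.card_fin] at this
  exact_mod_cast Nat.lt_succ_iff.1 this

end Order

/-- The image of a longest chain can be lengthened by `⊤` or `⊥` when `g` misses that end. -/
lemma not_krullDim_le_of_strictMono {α β : Type*} [PartialOrder α] [BoundedOrder α]
    [PartialOrder β] [BoundedOrder β] (hα : Order.krullDim α ≠ ⊤)
    {g : α → β} (hg : StrictMono g) (h : g ⊤ ≠ ⊤ ∨ g ⊥ ≠ ⊥) :
    ¬ Order.krullDim β ≤ Order.krullDim α := by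
  intro hle
  have hfd : FiniteDimensionalOrder α :=
    Order.finiteDimensionalOrder_iff_krullDim_ne_bot_and_top.2
      ⟨Order.krullDim_ne_bot_iff.2 ⟨⊥⟩, hα⟩
  let p := LTSeries.longestOf α
  have hp : Order.krullDim α = p.length := Order.krullDim_eq_length_of_finiteDimensionalOrder
  obtain ⟨q, hq⟩ : ∃ q : LTSeries β, q.length = p.length + 1 := by
    rcases h with h | h
    · refine ⟨(p.map g hg).snoc ⊤ ?_, rfl⟩
      exact (hg.monotone le_top).trans_lt (lt_top_iff_ne_top.2 h)
    · refine ⟨(p.map g hg).cons ⊥ ?_, RelSeries.cons_length _ _ _⟩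
      exact (bot_lt_iff_ne_bot.2 h).trans_le (hg.monotone bot_le)
  have h2 := (Order.LTSeries.length_le_krullDim q).trans hle
  rw [hq, hp] at h2
  have : p.length + 1 ≤ p.length := by exact_mod_cast h2
  omega

/-! ### Subobjects of additive functors -/

variable {𝒜 : Type u} [Category.{v} 𝒜] [Preadditive 𝒜]

lemma map_comp_apply' (A : AddRep.{w} 𝒜) {a b c : 𝒜} (f : a ⟶ b) (g : b ⟶ c)
    (x : A.obj.obj a) : A.obj.map (f ≫ g) x = A.obj.map g (A.obj.map f x) := by simp

lemma map_id_apply' (A : AddRep.{w} 𝒜) {a : 𝒜} (x : A.obj.obj a) :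
    A.obj.map (𝟙 a) x = x := by simp

lemma map_add_apply' (A : AddRep.{w} 𝒜) {a b : 𝒜} (f g : a ⟶ b)
    (x : A.obj.obj a) : A.obj.map (f + g) x = A.obj.map f x + A.obj.map g x := by simp

lemma map_zero_apply' (A : AddRep.{w} 𝒜) {a b : 𝒜}
    (x : A.obj.obj a) : A.obj.map (0 : a ⟶ b) x = 0 := by simp

lemma naturality_apply' {A B : AddRep.{w} 𝒜} (φ : A ⟶ B) {a b : 𝒜} (f : a ⟶ b)
    (x : A.obj.obj a) : φ.hom.app b (A.obj.map f x) = B.obj.map f (φ.hom.app a x) :=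
  congr($(φ.hom.naturality f) x)

/-- An additive subfunctor of an additive functor. -/
@[ext]
structure SubRep (A : AddRep.{w} 𝒜) where
  /-- The values of the subfunctor. -/
  carrier (a : 𝒜) : AddSubgroup (A.obj.obj a)
  map_mem {a b : 𝒜} (f : a ⟶ b) {x : A.obj.obj a} : x ∈ carrier a → A.obj.map f x ∈ carrier b

namespace SubRep

variable {A B : AddRep.{w} 𝒜}

instance : PartialOrder (SubRep A) :=
  PartialOrder.lift carrier fun _ _ h => SubRep.ext h

instance : Lattice (SubRep A) where
  sup S T :=
    { carrier := fun a => S.carrier a ⊔ T.carrier a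
      map_mem := fun {a b} f x hx => by
        obtain ⟨y, hy, z, hz, rfl⟩ := AddSubgroup.mem_sup.1 hx
        rw [map_add]
        exact AddSubgroup.add_mem_sup (S.map_mem f hy) (T.map_mem f hz) }
  inf S T :=
    { carrier := fun a => S.carrier a ⊓ T.carrier a
      map_mem := fun f _ hx => ⟨S.map_mem f hx.1, T.map_mem f hx.2⟩ }
  le_sup_left _ _ := fun _ => le_sup_left
  le_sup_right _ _ := fun _ => le_sup_right
  sup_le _ _ _ h h' := fun a => sup_le (h a) (h' a)
  inf_le_left _ _ := fun _ => inf_le_left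
  inf_le_right _ _ := fun _ => inf_le_right
  le_inf _ _ _ h h' := fun a => le_inf (h a) (h' a)

instance : BoundedOrder (SubRep A) where
  top := { carrier := fun _ => ⊤, map_mem := fun _ _ _ => trivial }
  bot := { carrier := fun _ => ⊥, map_mem := fun f x hx => by
            rw [AddSubgroup.mem_bot] at hx ⊢; rw [hx, map_zero] }
  le_top _ := fun _ => le_top
  bot_le _ := fun _ => bot_le

instance : IsModularLattice (SubRep A) where
  sup_inf_le_assoc_of_le T _ h a := sup_inf_le_assoc_of_le (T.carrier a) (h a)

/-- The functor underlying an additive subfunctor. -/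
def toFunctor (S : SubRep A) : 𝒜 ⥤ AddCommGrpCat.{w} where
  obj a := AddCommGrpCat.of (S.carrier a)
  map {a b} f := AddCommGrpCat.ofHom
    (((A.obj.map f).hom.comp (S.carrier a).subtype).codRestrict (S.carrier b)
      fun x => S.map_mem f x.2)
  map_id _ := AddCommGrpCat.hom_ext (AddMonoidHom.ext fun x =>
    Subtype.ext (map_id_apply' A x.1))
  map_comp f g := AddCommGrpCat.hom_ext (AddMonoidHom.ext fun x =>
    Subtype.ext (map_comp_apply' A f g x.1))

instance (S : SubRep A) : S.toFunctor.Additive where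
  map_add {_ _ f g} := AddCommGrpCat.hom_ext (AddMonoidHom.ext fun x =>
    Subtype.ext (map_add_apply' A f g x.1))

/-- An additive subfunctor as an additive functor. -/
def toRep (S : SubRep A) : AddRep.{w} 𝒜 :=
  AdditiveFunctor.of S.toFunctor

/-- The inclusion of an additive subfunctor. -/
def ι (S : SubRep A) : S.toRep ⟶ A :=
  ObjectProperty.homMk
    { app := fun a => AddCommGrpCat.ofHom (S.carrier a).subtype
      naturality := fun _ _ _ => rfl }

lemma hom_ext_apply {φ ψ : A ⟶ B} (h : ∀ a (x : A.obj.obj a), φ.hom.app a x = ψ.hom.app a x) :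
    φ = ψ := by
  refine ObjectProperty.hom_ext _ (NatTrans.ext (funext fun a => ?_))
  ext x
  exact h a x

instance (S : SubRep A) : Mono S.ι where
  right_cancellation _ _ e := hom_ext_apply fun a x =>
    Subtype.ext congr(($e).hom.app a x)

/-- The kernel of a morphism. -/
def ker (φ : A ⟶ B) : SubRep A where
  carrier a := (φ.hom.app a).hom.ker
  map_mem f x hx := by
    rw [AddMonoidHom.mem_ker] at hx ⊢
    exact (naturality_apply' φ f x).trans ((congrArg _ hx).trans (map_zero _))

/-- The preimage of a subfunctor. -/
def comap (φ : A ⟶ B) (T : SubRep B) : SubRep A where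
  carrier a := (T.carrier a).comap (φ.hom.app a).hom
  map_mem f x hx := by
    rw [AddSubgroup.mem_comap] at hx ⊢
    exact (naturality_apply' φ f x).symm ▸ T.map_mem f hx

/-- The image of a subfunctor. -/
def map (φ : A ⟶ B) (S : SubRep A) : SubRep B where
  carrier a := (S.carrier a).map (φ.hom.app a).hom
  map_mem f x hx := by
    obtain ⟨y, hy, rfl⟩ := hx
    exact ⟨A.obj.map f y, S.map_mem f hy, naturality_apply' φ f y⟩

lemma injective_of_mono (φ : A ⟶ B) [Mono φ] (a : 𝒜) : Function.Injective (φ.hom.app a) := by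
  refine (injective_iff_map_eq_zero (φ.hom.app a).hom).2 fun x hx => ?_
  have : (ker φ).ι = 0 := by
    rw [← cancel_mono φ, zero_comp]
    exact hom_ext_apply fun a x => x.2
  exact congr(($this).hom.app a (⟨x, hx⟩ : (ker φ).carrier a))

lemma isIso_of_bijective (φ : A ⟶ B) (h : ∀ a, Function.Bijective (φ.hom.app a)) : IsIso φ := by
  have : ∀ a, IsIso (((AdditiveFunctor.forget 𝒜 AddCommGrpCat).map φ).app a) := fun a =>
    (ConcreteCategory.isIso_iff_bijective _).2 (h a)
  have : IsIso ((AdditiveFunctor.forget 𝒜 AddCommGrpCat).map φ) := NatIso.isIso_of_isIso_app _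
  exact isIso_of_reflects_iso φ (AdditiveFunctor.forget 𝒜 AddCommGrpCat)

/-- The morphism to a subfunctor containing the image. -/
def lift (φ : A ⟶ B) (T : SubRep B) (h : ∀ a x, φ.hom.app a x ∈ T.carrier a) : A ⟶ T.toRep :=
  ObjectProperty.homMk
    { app := fun a => AddCommGrpCat.ofHom ((φ.hom.app a).hom.codRestrict (T.carrier a) (h a))
      naturality := fun _ _ f => AddCommGrpCat.hom_ext (AddMonoidHom.ext fun x =>
        Subtype.ext (naturality_apply' φ f x)) }

lemma lift_ι (φ : A ⟶ B) (T : SubRep B) (h : ∀ a x, φ.hom.app a x ∈ T.carrier a) :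
    lift φ T h ≫ T.ι = φ := rfl

/-- Subobjects of an additive functor are additive subfunctors. -/
def subobjectEquiv (A : AddRep.{w} 𝒜) : SubRep A ≃o Subobject A :=
  RelIso.ofSurjective
    (OrderEmbedding.ofMapLEIff (fun S : SubRep A => Subobject.mk S.ι) fun S T => by
      constructor
      · intro h a x hx
        have h1 := Subobject.ofMkLEMk_comp (f := S.ι) (g := T.ι) h
        have h2 := congr(($h1).hom.app a (⟨x, hx⟩ : S.carrier a))
        have h3 : ((Subobject.ofMkLEMk S.ι T.ι h).hom.app a ⟨x, hx⟩ : T.carrier a).1 = x := h2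
        exact h3 ▸ ((Subobject.ofMkLEMk S.ι T.ι h).hom.app a ⟨x, hx⟩ : T.carrier a).2
      · intro h
        exact Subobject.mk_le_mk_of_comm (lift S.ι T fun a x => h a x.2) (lift_ι _ _ _))
    fun X => by
      refine ⟨map X.arrow ⊤, ?_⟩
      let l := lift X.arrow (map X.arrow ⊤) fun a x => ⟨x, trivial, rfl⟩
      have hl : IsIso l := isIso_of_bijective _ fun a =>
        ⟨fun x y h => injective_of_mono X.arrow a congr(($h).1), fun y => by
          obtain ⟨x, -, hx⟩ := y.2
          exact ⟨x, Subtype.ext hx⟩⟩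
      conv_rhs => rw [← Subobject.mk_arrow X]
      refine (Subobject.mk_eq_mk_of_comm _ _ (asIso l).symm ?_)
      exact (Iso.inv_comp_eq (asIso l)).2 rfl

instance [IsNoetherianObject A] : WellFoundedGT (SubRep A) :=
  (subobjectEquiv A).toOrderEmbedding.wellFoundedGT

instance [IsArtinianObject A] : WellFoundedLT (SubRep A) :=
  (subobjectEquiv A).toOrderEmbedding.wellFoundedLT

lemma objLength_eq : objLength A = Order.krullDim (SubRep A) :=
  (Order.krullDim_eq_of_orderIso (subobjectEquiv A)).symm

/-- A finite object is not longer than a finite object of which it has a subquotient, unless they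
are isomorphic. -/
lemma isIso_of_surjective_of_objLength_le (hB : IsFiniteObject B) (h : objLength A ≤ objLength B)
    (D : SubRep A) (φ : D.toRep ⟶ B) (hφ : ∀ a, Function.Surjective (φ.hom.app a)) :
    D = ⊤ ∧ IsIso φ := by
  have := hB.isArtinian
  have := hB.isNoetherian
  rw [objLength_eq, objLength_eq] at h
  let g : SubRep B → SubRep A := fun T => map D.ι (comap φ T)
  have hg : StrictMono g := by
    have hle : ∀ S T, S ≤ T ↔ g S ≤ g T := fun S T => by
      constructor
      · rintro hST a _ ⟨x, hx, rfl⟩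
        exact ⟨x, hST a hx, rfl⟩
      · intro hST a y hy
        obtain ⟨x, rfl⟩ := hφ a y
        obtain ⟨z, hz, hzx⟩ := hST a ⟨x, hy, rfl⟩
        rw [← injective_of_mono D.ι a hzx]
        exact hz
    exact (OrderEmbedding.ofMapLEIff g fun S T => (hle S T).symm).strictMono
  by_contra hcon
  refine not_krullDim_le_of_strictMono krullDim_ne_top hg ?_ h
  by_contra! hcon'
  obtain ⟨h1, h2⟩ := hcon'
  refine hcon ⟨?_, isIso_of_bijective _ fun a => ⟨?_, hφ a⟩⟩
  · refine top_le_iff.1 (h1.ge.trans ?_)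
    rintro a _ ⟨x, -, rfl⟩
    exact x.2
  · refine (injective_iff_map_eq_zero (φ.hom.app a).hom).2 fun x hx => ?_
    have : D.ι.hom.app a x ∈ (g ⊥).carrier a := ⟨x, hx, rfl⟩
    rw [h2] at this
    exact injective_of_mono D.ι a ((AddSubgroup.mem_bot.1 this).trans (map_zero _).symm)

end SubRep

/-! ### Generating elements -/

variable {A B : AddRep.{w} 𝒜}

/-- An element `v` of `A(a)` is generating if it is contained in no proper subobject of `A`. -/
def IsGenerating {a : 𝒜} (v : A.obj.obj a) : Prop :=
  ∀ ⦃b : 𝒜⦄ (y : A.obj.obj b), ∃ f : a ⟶ b, A.obj.map f v = y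

/-- The subfunctor generated by an element. -/
def SubRep.span {a : 𝒜} (v : A.obj.obj a) : SubRep A where
  carrier b :=
    { carrier := Set.range fun f : a ⟶ b => A.obj.map f v
      add_mem' := by
        rintro _ _ ⟨f, rfl⟩ ⟨g, rfl⟩
        exact ⟨f + g, map_add_apply' A f g v⟩
      zero_mem' := ⟨0, map_zero_apply' A v⟩
      neg_mem' := by
        rintro _ ⟨f, rfl⟩
        exact ⟨-f, by simp⟩ }
  map_mem := by
    rintro b c g _ ⟨f, rfl⟩
    exact ⟨f ≫ g, map_comp_apply' A f g v⟩

lemma SubRep.mem_span {a b : 𝒜} (v : A.obj.obj a) (y : A.obj.obj b) :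
    y ∈ (SubRep.span v).carrier b ↔ ∃ f : a ⟶ b, A.obj.map f v = y := Iff.rfl

lemma SubRep.self_mem_span {a : 𝒜} (v : A.obj.obj a) : v ∈ (SubRep.span v).carrier a :=
  ⟨𝟙 a, map_id_apply' A v⟩

lemma SubRep.span_le {a : 𝒜} {v : A.obj.obj a} {S : SubRep A} :
    SubRep.span v ≤ S ↔ v ∈ S.carrier a := by
  refine ⟨fun h => h a (self_mem_span v), ?_⟩
  rintro h b _ ⟨f, rfl⟩
  exact S.map_mem f h

lemma span_eq_top_iff {a : 𝒜} (v : A.obj.obj a) : SubRep.span v = ⊤ ↔ IsGenerating v := by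
  refine ⟨fun h b y => ?_, fun h => top_le_iff.1 fun b y _ => h y⟩
  exact (SubRep.mem_span v y).1 (h.ge b trivial)

lemma IsGenerating.of_map {a b : 𝒜} {v : A.obj.obj a} (f : a ⟶ b)
    (h : IsGenerating (A.obj.map f v)) : IsGenerating v := fun c y => by
  obtain ⟨g, hg⟩ := h y
  exact ⟨f ≫ g, (map_comp_apply' A f g v).trans hg⟩

/-- Two elements `ξ`, `y` are both recovered by the projections from one element over the biproduct,
so cyclic subobjects are directed and a maximal one is everything. -/
lemma exists_isGenerating [HasFiniteBiproducts 𝒜] (A : AddRep.{w} 𝒜) [IsNoetherianObject A] :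
    ∃ (x : 𝒜) (ξ : A.obj.obj x), IsGenerating ξ := by
  have : HasBinaryBiproducts 𝒜 := hasBinaryBiproducts_of_finite_biproducts 𝒜
  have : HasZeroObject 𝒜 := hasZeroObject_of_hasFiniteBiproducts 𝒜
  let s : Set (SubRep A) := {S | ∃ (x : 𝒜) (ξ : A.obj.obj x), S = SubRep.span ξ}
  obtain ⟨_, ⟨x, ξ, rfl⟩, hmax⟩ := WellFounded.has_min (wellFounded_gt (α := SubRep A)) s
    ⟨_, ⟨(0 : 𝒜), 0, rfl⟩⟩
  refine ⟨x, ξ, (span_eq_top_iff ξ).1 (top_le_iff.1 fun b y _ => ?_)⟩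
  let ζ : A.obj.obj (x ⊞ b) := A.obj.map biprod.inl ξ + A.obj.map biprod.inr y
  have h1 : A.obj.map biprod.fst ζ = ξ := by
    rw [map_add, ← map_comp_apply', ← map_comp_apply', biprod.inl_fst, biprod.inr_fst,
      map_id_apply', map_zero_apply', add_zero]
  have h2 : A.obj.map biprod.snd ζ = y := by
    rw [map_add, ← map_comp_apply', ← map_comp_apply', biprod.inl_snd, biprod.inr_snd,
      map_id_apply', map_zero_apply', zero_add]
  have h3 : SubRep.span ξ ≤ SubRep.span ζ := SubRep.span_le.2 ⟨_, h1⟩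
  have h4 : SubRep.span ξ = SubRep.span ζ := by
    by_contra hne
    exact hmax _ ⟨_, ζ, rfl⟩ (lt_of_le_of_ne h3 hne)
  rw [h4]
  exact ⟨_, h2⟩

/-- A generating element presents `A` as a quotient of a representable functor, whose values are
finite. -/
lemma IsGenerating.finite {k : Type w} [Field k] (h𝒜 : IsKTrivial k 𝒜) {x : 𝒜} {ξ : A.obj.obj x}
    (h : IsGenerating ξ) (a : 𝒜) : Finite (A.obj.obj a) := by
  have := h𝒜.finite_hom x a
  exact Finite.of_surjective (fun f : x ⟶ a => A.obj.map f ξ) fun y => h y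

lemma IsGenerating.hom_ext {x : 𝒜} {ξ : A.obj.obj x} (h : IsGenerating ξ) {φ ψ : A ⟶ B}
    (e : φ.hom.app x ξ = ψ.hom.app x ξ) : φ = ψ := by
  refine SubRep.hom_ext_apply fun a y => ?_
  obtain ⟨f, rfl⟩ := h y
  rw [naturality_apply', naturality_apply', e]

/-- A morphism out of a functor with a generating element is given by an element satisfying the same
relations. -/
lemma IsGenerating.exists_hom {x : 𝒜} {ξ : A.obj.obj x} (h : IsGenerating ξ) (β : B.obj.obj x)
    (hβ : ∀ ⦃c : 𝒜⦄ (r : x ⟶ c), A.obj.map r ξ = 0 → B.obj.map r β = 0) :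
    ∃ φ : A ⟶ B, φ.hom.app x ξ = β := by
  have hwd : ∀ ⦃c : 𝒜⦄ (f g : x ⟶ c), A.obj.map f ξ = A.obj.map g ξ →
      B.obj.map f β = B.obj.map g β := fun c f g e => by
    -- Additivity turns an equality between two images of `ξ` into a relation of the form `r ξ = 0`.
    have := hβ (f - g) (by simp [e])
    rwa [← sub_eq_zero, ← show B.obj.map (f - g) β = B.obj.map f β - B.obj.map g β by simp]
  choose F hF using @h
  let φ (a : 𝒜) : A.obj.obj a →+ B.obj.obj a :=
    AddMonoidHom.mk' (fun y => B.obj.map (F y) β) fun y z => by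
      rw [← map_add_apply']
      exact hwd _ _ (by rw [map_add_apply', hF, hF, hF])
  refine ⟨ObjectProperty.homMk
    { app := fun a => AddCommGrpCat.ofHom (φ a)
      naturality := fun a b f => ?_ }, ?_⟩
  · ext y
    change B.obj.map (F (A.obj.map f y)) β = B.obj.map f (B.obj.map (F y) β)
    rw [← map_comp_apply']
    exact hwd _ _ (by rw [map_comp_apply', hF, hF])
  · change B.obj.map (F ξ) β = β
    rw [hwd (F ξ) (𝟙 x) (by rw [hF, map_id_apply']), map_id_apply']

/-! ### The proper part of `k[A]` -/

variable (k : Type w) [Field k]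

/-- An element fails to generate exactly when it lies in a proper subobject, namely the one it
spans. Hence `Q_A(a)` has a basis indexed by the generating elements. -/
lemma properPart_eq (A : AddRep.{w} 𝒜) (a : 𝒜) :
    properPart k A a = Finsupp.supported k k {v : A.obj.obj a | ¬ IsGenerating v} := by
  apply le_antisymm
  · refine iSup_le fun X => ?_
    refine (LinearMap.range_le_iff_comap.2 ?_)
    refine Submodule.eq_top_iff'.2 fun x => ?_
    refine Finsupp.induction_linear (motive := fun x => x ∈ Submodule.comap
      (Finsupp.lmapDomain k k (X.1.arrow.hom.app a))
      (Finsupp.supported k k {v : A.obj.obj a | ¬ IsGenerating v})) x (Submodule.zero_mem _)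
      (fun _ _ => Submodule.add_mem _) fun x r => ?_
    rw [Submodule.mem_comap, Finsupp.lmapDomain_apply, Finsupp.mapDomain_single]
    refine Finsupp.single_mem_supported k r fun h => X.2 ?_
    refine (Subobject.isIso_arrow_iff_eq_top X.1).1 (SubRep.isIso_of_bijective _ fun b =>
      ⟨SubRep.injective_of_mono _ b, fun y => ?_⟩)
    obtain ⟨f, rfl⟩ := h y
    exact ⟨_, naturality_apply' X.1.arrow f x⟩
  · rw [Finsupp.supported_eq_span_single]
    refine Submodule.span_le.2 ?_
    rintro _ ⟨v, hv, rfl⟩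
    let X := SubRep.subobjectEquiv A (SubRep.span v)
    have hX : X ≠ ⊤ := fun h => hv ((span_eq_top_iff v).1
      ((SubRep.subobjectEquiv A).injective (h.trans (map_top _).symm)))
    refine (le_iSup (fun X : {X : Subobject A // X ≠ ⊤} =>
      LinearMap.range (((linearization k).map X.1.arrow).app a).hom) ⟨X, hX⟩) ?_
    have hv' : X.arrow.hom.app a ((Subobject.underlyingIso (SubRep.span v).ι).inv.hom.app a
        (⟨v, SubRep.self_mem_span v⟩ : (SubRep.span v).carrier a)) = v :=
      congr(($(Subobject.underlyingIso_arrow (SubRep.span v).ι)).hom.app a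
        (⟨v, SubRep.self_mem_span v⟩ : (SubRep.span v).carrier a))
    refine ⟨Finsupp.single ((Subobject.underlyingIso (SubRep.span v).ι).inv.hom.app a
        (⟨v, SubRep.self_mem_span v⟩ : (SubRep.span v).carrier a)) 1, ?_⟩
    exact Finsupp.mapDomain_single.trans (congrArg (fun y => Finsupp.single y (1 : k)) hv')

end

/-! ### Coordinates on the values of `Q_{A,V}` -/

section

variable {𝒜 : Type u} [Category.{v} 𝒜] [Preadditive 𝒜] {k : Type w} [Field k]
  {A : AddRep.{w} 𝒜}

instance (a : 𝒜) : MulAction (Aut A) (A.obj.obj a) where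
  smul g v := g.hom.hom.app a v
  one_smul _ := rfl
  mul_smul _ _ _ := rfl

lemma map_aut_smul {a b : 𝒜} (f : a ⟶ b) (g : Aut A) (v : A.obj.obj a) :
    A.obj.map f (g • v) = g • A.obj.map f v :=
  (naturality_apply' g.hom f v).symm

lemma IsGenerating.aut_smul {a : 𝒜} {v : A.obj.obj a} (h : IsGenerating v) (g : Aut A) :
    IsGenerating (g • v) := fun b y => by
  obtain ⟨f, hf⟩ := h (g⁻¹ • y)
  exact ⟨f, by rw [map_aut_smul, hf, smul_inv_smul]⟩

lemma isGenerating_aut_smul_iff {a : 𝒜} {v : A.obj.obj a} (g : Aut A) :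
    IsGenerating (g • v) ↔ IsGenerating v :=
  ⟨fun h => by simpa using h.aut_smul g⁻¹, fun h => h.aut_smul g⟩

/-- Freeness of the action on generating elements; it makes coefficients well defined and makes
`Q_{A,-}` behave like a sum of copies of the identity, one for each orbit. -/
lemma IsGenerating.aut_eq {a : 𝒜} {v : A.obj.obj a} (h : IsGenerating v) {g g' : Aut A}
    (e : g • v = g' • v) : g = g' :=
  Aut.ext (h.hom_ext e)

variable (V W : Rep.{w} k (Aut A))

/-- The value at `a` of the functor `Q_{A, V}`. -/
abbrev QObj (V : Rep.{w} k (Aut A)) (a : 𝒜) : ModuleCat.{w} k :=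
  ((Rep.coinvariantsTensor k (Aut A)).obj V).obj ((QA k A).obj a)

/-- The projection from `k[A(a)]` to `Q_A(a)`. -/
def proj (k : Type w) [Field k] (A : AddRep.{w} 𝒜) (a : 𝒜) :
    (A.obj.obj a →₀ k) →ₗ[k] (QA k A).obj a :=
  (properPart k A a).mkQ

lemma proj_surjective (a : 𝒜) : Function.Surjective (proj k A a) :=
  (properPart k A a).mkQ_surjective

lemma proj_single_eq_zero {a : 𝒜} {v : A.obj.obj a} (hv : ¬ IsGenerating v) (r : k) :
    proj k A a (Finsupp.single v r) = 0 := by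
  refine (Submodule.Quotient.mk_eq_zero _).2 ?_
  rw [properPart_eq]
  exact Finsupp.single_mem_supported k r hv

lemma ρ_proj_single {a : 𝒜} (g : Aut A) (v : A.obj.obj a) (r : k) :
    ((QA k A).obj a).ρ g (proj k A a (Finsupp.single v r)) =
      proj k A a (Finsupp.single (g • v) r) :=
  congrArg (properPart k A a).mkQ Finsupp.mapDomain_single

/-- A linear map from `k[A(a)]` vanishing on the elements that are not generating factors through
`Q_A(a)`. -/
def projDesc {a : 𝒜} {X : Type*} [AddCommGroup X] [Module k X] (φ : A.obj.obj a → X)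
    (hφ : ∀ v, ¬ IsGenerating v → φ v = 0) : (QA k A).obj a →ₗ[k] X :=
  (properPart k A a).liftQ (Finsupp.linearCombination k φ) (by
    rw [properPart_eq]
    intro x hx
    refine LinearMap.mem_ker.2 ((Finsupp.linearCombination_apply k x).trans ?_)
    refine Finset.sum_eq_zero fun v hv => ?_
    exact (congrArg (_ • ·) (hφ v (hx hv))).trans (smul_zero _))

lemma projDesc_proj_single {a : 𝒜} {X : Type*} [AddCommGroup X] [Module k X]
    (φ : A.obj.obj a → X) (hφ : ∀ v, ¬ IsGenerating v → φ v = 0) (v : A.obj.obj a) (r : k) :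
    projDesc φ hφ (proj k A a (Finsupp.single v r)) = r • φ v :=
  Finsupp.linearCombination_single k r v

/-- The class of `m ⊗ [v]`. -/
def qmk {a : 𝒜} (v : A.obj.obj a) : V →ₗ[k] QObj V a :=
  (Rep.coinvariantsTensorMk V ((QA k A).obj a)).flip (proj k A a (Finsupp.single v 1))

variable {V W}

lemma qmk_eq_zero {a : 𝒜} {v : A.obj.obj a} (hv : ¬ IsGenerating v) (m : V) :
    qmk V v m = 0 :=
  (congrArg (fun q => Rep.coinvariantsTensorMk V ((QA k A).obj a) m q)
    (proj_single_eq_zero hv 1)).trans (map_zero _)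

lemma qmk_aut {a : 𝒜} (g : Aut A) (v : A.obj.obj a) (m : V) :
    qmk V (g • v) (V.ρ g m) = qmk V v m := by
  have h := Representation.Coinvariants.mk_self_apply (V.ρ.tprod ((QA k A).obj a).ρ) g
    (m ⊗ₜ[k] proj k A a (Finsupp.single v 1))
  refine Eq.trans ?_ h
  refine congrArg (Representation.Coinvariants.mk (V.ρ.tprod ((QA k A).obj a).ρ)) ?_
  refine Eq.trans ?_ (TensorProduct.map_tmul _ _ _ _).symm
  exact congrArg _ (ρ_proj_single g v 1).symm

lemma QObj.induction {a : 𝒜} {P : QObj V a → Prop} (zero : P 0)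
    (add : ∀ x y, P x → P y → P (x + y))
    (mk : ∀ (v : A.obj.obj a) (m : V), IsGenerating v → P (qmk V v m)) (x : QObj V a) : P x := by
  obtain ⟨t, rfl⟩ := Representation.Coinvariants.mk_surjective
    (V.ρ.tprod ((QA k A).obj a).ρ) x
  induction t using TensorProduct.induction_on with
  | zero => rw [map_zero]; exact zero
  | add x y hx hy => rw [map_add]; exact add _ _ hx hy
  | tmul m q =>
    obtain ⟨q, rfl⟩ := proj_surjective a q
    induction q using Finsupp.induction_linear with
    | zero => rw [map_zero, TensorProduct.tmul_zero, map_zero]; exact zero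
    | add x y hx hy => rw [map_add, TensorProduct.tmul_add, map_add]; exact add _ _ hx hy
    | single v r =>
      have h : m ⊗ₜ[k] proj k A a (Finsupp.single v r) =
          (r • m) ⊗ₜ[k] proj k A a (Finsupp.single v 1) := by
        rw [TensorProduct.smul_tmul, ← map_smul, Finsupp.smul_single, smul_eq_mul, mul_one]
      rw [h]
      by_cases hv : IsGenerating v
      · exact mk v (r • m) hv
      · exact (qmk_eq_zero hv (r • m) : qmk V v (r • m) = 0) ▸ zero

lemma QObj.map_qmk {a b : 𝒜} (f : a ⟶ b) (v : A.obj.obj a) (m : V) :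
    (((Rep.coinvariantsTensor k (Aut A)).obj V).map ((QA k A).map f)).hom (qmk V v m) =
      qmk V (A.obj.map f v) m :=
  congrArg (fun q => Rep.coinvariantsTensorMk V ((QA k A).obj b) m q)
    (congrArg (properPart k A b).mkQ Finsupp.mapDomain_single)

lemma QObj.map_left_qmk {a : 𝒜} (φ : V ⟶ W) (v : A.obj.obj a) (m : V) :
    (((Rep.coinvariantsTensor k (Aut A)).map φ).app ((QA k A).obj a)).hom (qmk V v m) =
      qmk W v (φ.hom m) := rfl

open scoped Classical in
/-- The endomorphism of `V` given by the automorphism of `A` sending `v` to `β`, if there is one. -/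
def autCoeff (V : Rep.{w} k (Aut A)) {a : 𝒜} (β v : A.obj.obj a) : V →ₗ[k] V :=
  if h : IsGenerating β ∧ ∃ g : Aut A, g • v = β then V.ρ h.2.choose else 0

lemma autCoeff_of_smul_eq {a : 𝒜} {β v : A.obj.obj a} (hβ : IsGenerating β) (g : Aut A)
    (h : g • v = β) : autCoeff V β v = V.ρ g := by
  have h' : IsGenerating β ∧ ∃ g : Aut A, g • v = β := ⟨hβ, g, h⟩
  rw [autCoeff, dif_pos h']
  congr 1
  refine IsGenerating.aut_eq (v := v) ?_ (h'.2.choose_spec.trans h.symm)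
  rwa [← isGenerating_aut_smul_iff g, h]

lemma autCoeff_of_forall_ne {a : 𝒜} {β v : A.obj.obj a} (h : ∀ g : Aut A, g • v ≠ β) :
    autCoeff V β v = 0 := by
  rw [autCoeff, dif_neg fun h' => h _ h'.2.choose_spec]

lemma autCoeff_of_not_isGenerating {a : 𝒜} {β v : A.obj.obj a} (h : ¬ IsGenerating β) :
    autCoeff V β v = 0 := by
  rw [autCoeff, dif_neg fun h' => h h'.1]

lemma autCoeff_of_not_isGenerating_right {a : 𝒜} {β v : A.obj.obj a} (h : ¬ IsGenerating v) :
    autCoeff V β v = 0 := by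
  rw [autCoeff, dif_neg fun h' => h ?_]
  obtain ⟨h1, g, rfl⟩ := h'
  exact (isGenerating_aut_smul_iff g).1 h1

/-- The invariance needed for coefficients to descend to the coinvariants of the diagonal action. -/
lemma autCoeff_smul_right {a : 𝒜} (β v : A.obj.obj a) (g : Aut A) (m : V) :
    autCoeff V β (g • v) (V.ρ g m) = autCoeff V β v m := by
  by_cases hβ : IsGenerating β
  · by_cases h : ∃ g' : Aut A, g' • v = β
    · obtain ⟨g', hg'⟩ := h
      rw [autCoeff_of_smul_eq hβ g' hg',
        autCoeff_of_smul_eq hβ (g' * g⁻¹) (by rw [mul_smul, inv_smul_smul, hg']),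
        ← Module.End.mul_apply, ← map_mul, inv_mul_cancel_right]
    · push Not at h
      rw [autCoeff_of_forall_ne h, autCoeff_of_forall_ne fun g' hg' => h (g' * g)
        (by rw [mul_smul, hg'])]
      rfl
  · rw [autCoeff_of_not_isGenerating hβ, autCoeff_of_not_isGenerating hβ]
    rfl

/-- The coefficient of an element of `Q_{A, V}(a)` at an element `β` of `A(a)`. -/
def coeff (V : Rep.{w} k (Aut A)) {a : 𝒜} (β : A.obj.obj a) : QObj V a →ₗ[k] V :=
  Representation.Coinvariants.lift (V.ρ.tprod ((QA k A).obj a).ρ)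
    (TensorProduct.lift (LinearMap.flip (projDesc (autCoeff V β)
      fun _ => autCoeff_of_not_isGenerating_right)))
    (fun g => by
      refine TensorProduct.ext' fun m q => ?_
      obtain ⟨q, rfl⟩ := proj_surjective a q
      rw [LinearMap.comp_apply, Representation.tprod_apply, TensorProduct.map_tmul,
        TensorProduct.lift.tmul, TensorProduct.lift.tmul, LinearMap.flip_apply,
        LinearMap.flip_apply]
      induction q using Finsupp.induction_linear with
      | zero => simp only [map_zero, LinearMap.zero_apply]
      | add x y hx hy => simp only [map_add, LinearMap.add_apply, hx, hy]
      | single v r =>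
        rw [ρ_proj_single, projDesc_proj_single, projDesc_proj_single, LinearMap.smul_apply,
          LinearMap.smul_apply, autCoeff_smul_right])

lemma coeff_qmk {a : 𝒜} (β v : A.obj.obj a) (m : V) :
    coeff V β (qmk V v m) = autCoeff V β v m := by
  change projDesc (autCoeff V β) (fun _ => autCoeff_of_not_isGenerating_right)
    (proj k A a (Finsupp.single v 1)) m = _
  rw [projDesc_proj_single, one_smul]

lemma coeff_qmk_self {a : 𝒜} {v : A.obj.obj a} (hv : IsGenerating v) (m : V) :
    coeff V v (qmk V v m) = m := by
  rw [coeff_qmk, autCoeff_of_smul_eq hv 1 (one_smul _ v), map_one]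
  rfl

lemma coeff_smul {a : 𝒜} (g : Aut A) (β : A.obj.obj a) (z : QObj V a) :
    coeff V (g • β) z = V.ρ g (coeff V β z) := by
  induction z using QObj.induction with
  | zero => simp only [map_zero]
  | add x y hx hy => rw [map_add, hx, hy, map_add, map_add]
  | mk v m hv =>
    rw [coeff_qmk, coeff_qmk]
    by_cases hβ : IsGenerating β
    · by_cases h : ∃ g' : Aut A, g' • v = β
      · obtain ⟨g', hg'⟩ := h
        rw [autCoeff_of_smul_eq hβ g' hg',
          autCoeff_of_smul_eq (hβ.aut_smul g) (g * g') (by rw [mul_smul, hg']), map_mul]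
        rfl
      · push Not at h
        rw [autCoeff_of_forall_ne h, autCoeff_of_forall_ne fun g' hg' => h (g⁻¹ * g')
          (by rw [mul_smul, hg', inv_smul_smul])]
        exact (map_zero _).symm
    · rw [autCoeff_of_not_isGenerating hβ,
        autCoeff_of_not_isGenerating fun h => hβ ((isGenerating_aut_smul_iff g).1 h)]
      exact (map_zero _).symm

lemma coeff_map_left (φ : V ⟶ W) {a : 𝒜} (β : A.obj.obj a) (z : QObj V a) :
    coeff W β ((((Rep.coinvariantsTensor k (Aut A)).map φ).app ((QA k A).obj a)).hom z) =
      φ.hom (coeff V β z) := by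
  induction z using QObj.induction with
  | zero => simp only [map_zero]
  | add x y hx hy => rw [map_add, map_add, hx, hy, map_add, map_add]
  | mk v m hv =>
    rw [QObj.map_left_qmk, coeff_qmk, coeff_qmk]
    by_cases h : IsGenerating β ∧ ∃ g' : Aut A, g' • v = β
    · obtain ⟨hβ, g, hg⟩ := h
      rw [autCoeff_of_smul_eq hβ g hg, autCoeff_of_smul_eq hβ g hg]
      exact (Rep.hom_comm_apply φ g m).symm
    · rw [autCoeff, dif_neg h, autCoeff, dif_neg h]
      exact (map_zero _).symm

section Finite

open scoped Classical in
/-- The coefficients of the image of an element under a morphism of `𝒜` are obtained by summing over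
the fibres. -/
lemma coeff_map {a b : 𝒜} [Fintype (A.obj.obj a)] (f : a ⟶ b) {β : A.obj.obj b}
    (hβ : IsGenerating β) (z : QObj V a) :
    coeff V β ((((Rep.coinvariantsTensor k (Aut A)).obj V).map ((QA k A).map f)).hom z) =
      ∑ v with A.obj.map f v = β, coeff V v z := by
  induction z using QObj.induction with
  | zero => simp only [map_zero, Finset.sum_const_zero]
  | add x y hx hy => rw [map_add, map_add, hx, hy, ← Finset.sum_add_distrib]; simp only [map_add]
  | mk v m hv =>
    rw [QObj.map_qmk, coeff_qmk]
    simp only [coeff_qmk]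
    by_cases h : ∃ g : Aut A, g • A.obj.map f v = β
    · obtain ⟨g, hg⟩ := h
      -- By freeness at the generating element `f v`, the fibre over `β` meets the orbit of `v` only
      -- in `g • v`.
      rw [autCoeff_of_smul_eq hβ g hg, Finset.sum_eq_single (g • v)]
      · rw [autCoeff_of_smul_eq (hv.aut_smul g) g rfl]
      · intro v' hv' hne
        rw [Finset.mem_filter_univ] at hv'
        rw [autCoeff_of_forall_ne]
        · rfl
        · rintro g' rfl
          refine hne ?_
          rw [map_aut_smul, ← hg] at hv'
          rw [IsGenerating.aut_eq (v := A.obj.map f v) ?_ hv']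
          rwa [← isGenerating_aut_smul_iff g, hg]
      · intro h'
        exact absurd (by rw [Finset.mem_filter_univ, map_aut_smul, hg]) h'
    · push Not at h
      rw [autCoeff_of_forall_ne h]
      refine (Finset.sum_eq_zero fun v' hv' => ?_).symm
      rw [Finset.mem_filter_univ] at hv'
      rw [autCoeff_of_forall_ne]
      · rfl
      · rintro g rfl
        exact h g (by rw [← map_aut_smul, hv'])

/-- The orbits of `Aut A` on the generating elements. -/
abbrev GenOrbit (A : AddRep.{w} 𝒜) (a : 𝒜) :=
  {o : MulAction.orbitRel.Quotient (Aut A) (A.obj.obj a) // IsGenerating (Quotient.out o)}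

/-- One representative per free orbit suffices to recover an element from its coefficients; hence
elements are determined by their coefficients, and every equivariant family of coefficients occurs.
-/
lemma sum_coeff_qmk {a : 𝒜} [Fintype (GenOrbit A a)] (z : QObj V a) :
    ∑ o : GenOrbit A a, qmk V (Quotient.out o.1) (coeff V (Quotient.out o.1) z) = z := by
  induction z using QObj.induction with
  | zero => simp only [map_zero, Finset.sum_const_zero]
  | add x y hx hy =>
    conv_rhs => rw [← hx, ← hy]
    rw [← Finset.sum_add_distrib]; simp only [map_add]
  | mk v m hv =>
    obtain ⟨g, hg⟩ : ∃ g : Aut A, g • v = Quotient.out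
        (Quotient.mk'' v : MulAction.orbitRel.Quotient (Aut A) (A.obj.obj a)) :=
      MulAction.orbitRel_apply.1 (Quotient.exact (Quotient.out_eq _))
    rw [Finset.sum_eq_single ⟨Quotient.mk'' v, hg ▸ hv.aut_smul g⟩]
    · dsimp only
      rw [← hg, coeff_smul, coeff_qmk_self hv, qmk_aut]
    · rintro ⟨o, ho⟩ - hne
      rw [coeff_qmk, autCoeff_of_forall_ne]
      · exact map_zero _
      · intro g' hg'
        refine hne (Subtype.ext ?_)
        dsimp only
        rw [← Quotient.out_eq o, ← hg']
        exact Quotient.sound ⟨g', rfl⟩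
    · exact fun h => absurd (Finset.mem_univ _) h

lemma QObj.ext_coeff {a : 𝒜} [Finite (A.obj.obj a)] {z z' : QObj V a}
    (h : ∀ β : A.obj.obj a, IsGenerating β → coeff V β z = coeff V β z') : z = z' := by
  have : Fintype (GenOrbit A a) := Fintype.ofFinite _
  rw [← sum_coeff_qmk z, ← sum_coeff_qmk z']
  exact Finset.sum_congr rfl fun o _ => by rw [h _ o.2]

/-- An element of `Q_{A, V}(a)` with prescribed coefficients. -/
lemma QObj.exists_coeff_eq {a : 𝒜} [Finite (A.obj.obj a)] (c : A.obj.obj a → V)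
    (hc : ∀ (g : Aut A) β, IsGenerating β → c (g • β) = V.ρ g (c β)) :
    ∃ z : QObj V a, ∀ β, IsGenerating β → coeff V β z = c β := by
  have : Fintype (GenOrbit A a) := Fintype.ofFinite _
  refine ⟨∑ o : GenOrbit A a, qmk V (Quotient.out o.1) (c (Quotient.out o.1)), fun β hβ => ?_⟩
  obtain ⟨g, hg⟩ : ∃ g : Aut A, g • β = Quotient.out
      (Quotient.mk'' β : MulAction.orbitRel.Quotient (Aut A) (A.obj.obj a)) :=
    MulAction.orbitRel_apply.1 (Quotient.exact (Quotient.out_eq _))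
  have hβ' : β = g⁻¹ • Quotient.out
      (Quotient.mk'' β : MulAction.orbitRel.Quotient (Aut A) (A.obj.obj a)) := by
    rw [← hg, inv_smul_smul]
  have hgen := hg ▸ hβ.aut_smul g
  rw [map_sum, Finset.sum_eq_single ⟨Quotient.mk'' β, hgen⟩]
  · dsimp only
    conv_rhs => rw [hβ']
    rw [hc _ _ hgen, coeff_qmk, autCoeff_of_smul_eq hβ g⁻¹ hβ'.symm]
  · rintro ⟨o, ho⟩ - hne
    rw [coeff_qmk, autCoeff_of_forall_ne]
    · rfl
    · intro g' hg'
      refine hne (Subtype.ext ?_)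
      dsimp only
      rw [← Quotient.out_eq o, ← hg']
      exact Quotient.sound ⟨g'⁻¹, inv_smul_smul g' _⟩
  · exact fun h => absurd (Finset.mem_univ _) h

end Finite

end

section

/-! ### Functors to vector spaces and linearised set functors -/

section FunctorCategory

variable {𝒜 : Type u} [Category.{v} 𝒜] {k : Type w} [Field k]

lemma FunRep.exact_iff (S : ShortComplex (FunRep k 𝒜)) :
    S.Exact ↔ ∀ (a : 𝒜) (x : S.X₂.obj a), (S.g.app a).hom x = 0 →
      ∃ y : S.X₁.obj a, (S.f.app a).hom y = x := by
  have h : S.Exact ↔ ∀ a : 𝒜, (S.map ((evaluation 𝒜 (ModuleCat k)).obj a)).Exact := by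
    rw [S.exact_iff_isZero_homology, Functor.isZero_iff]
    refine forall_congr' fun a => ?_
    rw [ShortComplex.exact_iff_isZero_homology]
    exact (S.mapHomologyIso ((evaluation 𝒜 (ModuleCat k)).obj a)).isZero_iff.symm
  rw [h]
  exact forall_congr' fun a => ShortComplex.moduleCat_exact_iff _

lemma FunRep.epi_iff {F G : FunRep k 𝒜} (φ : F ⟶ G) :
    Epi φ ↔ ∀ a, Function.Surjective (φ.app a).hom := by
  rw [NatTrans.epi_iff_epi_app]
  exact forall_congr' fun a => ModuleCat.epi_iff_surjective _

lemma FunRep.mono_iff {F G : FunRep k 𝒜} (φ : F ⟶ G) :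
    Mono φ ↔ ∀ a, Function.Injective (φ.app a).hom := by
  rw [NatTrans.mono_iff_mono_app]
  exact forall_congr' fun a => ModuleCat.mono_iff_injective _

lemma FunRep.naturality_apply {F G : FunRep k 𝒜} (φ : F ⟶ G) {a b : 𝒜} (f : a ⟶ b)
    (x : F.obj a) : (φ.app b).hom ((F.map f).hom x) = (G.map f).hom ((φ.app a).hom x) :=
  congr($(φ.naturality f).hom x)

/-- The functor `a ↦ k[X(a)]` associated with a functor `X` to sets. -/
abbrev lin (k : Type w) [Field k] (X : 𝒜 ⥤ Type w) : FunRep k 𝒜 :=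
  X ⋙ ModuleCat.free k

/-- The basis element of `k[X(a)]` associated with an element of `X(a)`. -/
def pt (k : Type w) [Field k] {X : 𝒜 ⥤ Type w} {a : 𝒜} (x : X.obj a) : (lin k X).obj a :=
  ModuleCat.freeMk x

variable {X Y : 𝒜 ⥤ Type w} {F : FunRep k 𝒜}

lemma lin_map_pt {a b : 𝒜} (f : a ⟶ b) (x : X.obj a) :
    ((lin k X).map f).hom (pt k x) = pt k (X.map f x) :=
  ModuleCat.free_map_apply _ _

lemma lin_induction {a : 𝒜} {P : (lin k X).obj a → Prop} (zero : P 0)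
    (add : ∀ x y, P x → P y → P (x + y)) (smul : ∀ (r : k) x, P x → P (r • x))
    (pt : ∀ x : X.obj a, P (pt k x)) (z : (lin k X).obj a) : P z := by
  refine Finsupp.induction_linear (motive := P) z zero add fun x r => ?_
  have h := smul r _ (pt x)
  exact (show r • GenericRep.pt k x = Finsupp.single x r from
    (Finsupp.smul_single r x 1).trans (by rw [smul_eq_mul, mul_one])) ▸ h

lemma linMap_ext {a : 𝒜} {M : Type*} [AddCommGroup M] [Module k M]
    {φ ψ : (lin k X).obj a →ₗ[k] M} (h : ∀ x : X.obj a, φ (pt k x) = ψ (pt k x)) : φ = ψ :=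
  Finsupp.lhom_ext' fun x => LinearMap.ext_ring (h x)

/-- The linear map out of `k[X(a)]` with prescribed values on the basis. -/
def linMapDesc {a : 𝒜} {M : Type*} [AddCommGroup M] [Module k M]
    (φ : X.obj a → M) : (lin k X).obj a →ₗ[k] M :=
  Finsupp.linearCombination k φ

lemma linMapDesc_pt {a : 𝒜} {M : Type*} [AddCommGroup M] [Module k M]
    (φ : X.obj a → M) (x : X.obj a) : linMapDesc φ (pt k x) = φ x :=
  (Finsupp.linearCombination_single k 1 x).trans (one_smul _ _)

lemma lin_hom_ext {φ ψ : lin k X ⟶ F}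
    (h : ∀ a (x : X.obj a), (φ.app a).hom (pt k x) = (ψ.app a).hom (pt k x)) : φ = ψ :=
  NatTrans.ext (funext fun a => ModuleCat.hom_ext (linMap_ext (h a)))

/-- The morphism out of `k[X]` induced by a natural transformation. -/
def linDesc (φ : ∀ a, X.obj a → F.obj a)
    (hφ : ∀ {a b} (f : a ⟶ b) (x : X.obj a), φ b (X.map f x) = (F.map f).hom (φ a x)) :
    lin k X ⟶ F where
  app a := ModuleCat.ofHom (linMapDesc (φ a))
  naturality a b f := ModuleCat.hom_ext (linMap_ext fun x => by
    refine (congrArg (linMapDesc (φ b)) (lin_map_pt f x)).trans ?_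
    refine (linMapDesc_pt _ _).trans ((hφ f x).trans ?_)
    exact congrArg (F.map f).hom (linMapDesc_pt (φ a) x).symm)

lemma linDesc_pt (φ : ∀ a, X.obj a → F.obj a)
    (hφ : ∀ {a b} (f : a ⟶ b) (x : X.obj a), φ b (X.map f x) = (F.map f).hom (φ a x))
    {a : 𝒜} (x : X.obj a) : ((linDesc φ hφ).app a).hom (pt k x) = φ a x :=
  linMapDesc_pt _ _

lemma app_pt_naturality (φ : lin k X ⟶ F) {a b : 𝒜} (f : a ⟶ b) (x : X.obj a) :
    (φ.app b).hom (pt k (X.map f x)) = (F.map f).hom ((φ.app a).hom (pt k x)) := by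
  rw [← lin_map_pt, FunRep.naturality_apply]

end FunctorCategory

/-! ### Covers by representable functors -/

variable {𝒜 : Type u} [Category.{v} 𝒜]

lemma type_map_comp_apply (X : 𝒜 ⥤ Type w) {a b c : 𝒜} (f : a ⟶ b) (g : b ⟶ c) (x : X.obj a) :
    X.map (f ≫ g) x = X.map g (X.map f x) := by simp

lemma type_map_id_apply (X : 𝒜 ⥤ Type w) {a : 𝒜} (x : X.obj a) :
    X.map (𝟙 a) x = x := by simp

section Cover

variable [EssentiallySmall.{w} 𝒜]

/-- The object of `𝒜` corresponding to an object of its small model. -/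
abbrev ofModel (s : SmallModel.{w} 𝒜) : 𝒜 := (equivSmallModel 𝒜).inverse.obj s

/-- Every object is isomorphic to an object coming from the small model. -/
lemma exists_ofModel_iso (b : 𝒜) : ∃ s : SmallModel.{w} 𝒜, Nonempty (ofModel s ≅ b) :=
  ⟨_, ⟨((equivSmallModel.{w} 𝒜).unitIso.app b).symm⟩⟩

/-- An element at `b` of the disjoint union of the representable functors indexed by the elements
of `X`. -/
structure CoverElt (X : 𝒜 ⥤ Type w) (b : 𝒜) : Type w where
  /-- The index of the source. -/
  source : SmallModel.{w} 𝒜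
  /-- The element of `X` indexing the representable functor. -/
  elt : X.obj (ofModel source)
  /-- The morphism, up to shrinking. -/
  shrunkHom : Shrink.{w} (ofModel source ⟶ b)

namespace CoverElt

variable {X : 𝒜 ⥤ Type w} {b c : 𝒜}

/-- The morphism underlying an element of the cover. -/
def hom (t : CoverElt X b) : ofModel t.source ⟶ b := (equivShrink _).symm t.shrunkHom

/-- The element of the cover given by an element of `X` and a morphism. -/
def of {s : SmallModel.{w} 𝒜} (v : X.obj (ofModel s)) (g : ofModel s ⟶ b) : CoverElt X b :=
  ⟨s, v, equivShrink _ g⟩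

lemma hom_of {s : SmallModel.{w} 𝒜} (v : X.obj (ofModel s)) (g : ofModel s ⟶ b) :
    (of v g).hom = g := Equiv.symm_apply_apply _ _

lemma of_hom (t : CoverElt X b) : of t.elt t.hom = t :=
  congrArg (CoverElt.mk t.source t.elt) (Equiv.apply_symm_apply _ _)

lemma of_injective {s : SmallModel.{w} 𝒜} (v : X.obj (ofModel s)) {g g' : ofModel s ⟶ b}
    (h : of v g = of v g') : g = g' := by
  rw [of, of, CoverElt.mk.injEq] at h
  exact (equivShrink _).injective (eq_of_heq h.2.2)

lemma exists_eq_of (t : CoverElt X b) (t' : CoverElt X c) (h : t.source = t'.source)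
    (h' : HEq t.elt t'.elt) : ∃ (s : SmallModel.{w} 𝒜) (v : X.obj (ofModel s)) (g : ofModel s ⟶ b)
      (g' : ofModel s ⟶ c), t = of v g ∧ t' = of v g' := by
  obtain ⟨s, v, g⟩ := t
  obtain ⟨s', v', g'⟩ := t'
  obtain rfl : s = s' := h
  obtain rfl := eq_of_heq h'
  exact ⟨s, v, _, _, (of_hom _).symm, (of_hom _).symm⟩

end CoverElt

/-- The disjoint union of the representable functors indexed by the elements of `X`. -/
def cover (X : 𝒜 ⥤ Type w) : 𝒜 ⥤ Type w where
  obj b := CoverElt X b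
  map f := ↾fun t => CoverElt.of t.elt (t.hom ≫ f)
  map_id a := by
    ext t
    exact (congrArg (CoverElt.of _) (Category.comp_id _)).trans t.of_hom
  map_comp f g := by
    ext t
    refine congrArg (CoverElt.of t.elt) ?_
    exact (Category.assoc _ _ _).symm.trans
      (congrArg (· ≫ g) (CoverElt.hom_of t.elt (t.hom ≫ f)).symm)

variable {X : 𝒜 ⥤ Type w}

/-- The element of the cover given by an element of `X` and a morphism. -/
def cover.mk {s : SmallModel.{w} 𝒜} (v : X.obj (ofModel s)) {b : 𝒜} (g : ofModel s ⟶ b) :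
    (cover X).obj b := CoverElt.of v g

lemma cover.exists_eq_mk {b : 𝒜} (t : (cover X).obj b) :
    ∃ (s : SmallModel.{w} 𝒜) (v : X.obj (ofModel s)) (g : ofModel s ⟶ b), t = cover.mk v g :=
  ⟨t.source, t.elt, t.hom, t.of_hom.symm⟩

lemma cover.map_mk {s : SmallModel.{w} 𝒜} (v : X.obj (ofModel s)) {b c : 𝒜} (g : ofModel s ⟶ b)
    (f : b ⟶ c) : (cover X).map f (cover.mk v g) = cover.mk v (g ≫ f) :=
  congrArg (fun h => CoverElt.of v (h ≫ f)) (CoverElt.hom_of v g)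

lemma cover.mk_injective {s : SmallModel.{w} 𝒜} (v : X.obj (ofModel s)) {b : 𝒜}
    {g g' : ofModel s ⟶ b} (h : cover.mk v g = cover.mk v g') : g = g' :=
  CoverElt.of_injective v h

lemma cover.exists_eq_mk_of_map_eq {a c e : 𝒜} (t : (cover X).obj a) (t' : (cover X).obj c)
    (f : a ⟶ e) (f' : c ⟶ e) (h : (cover X).map f t = (cover X).map f' t') :
    ∃ (s : SmallModel.{w} 𝒜) (v : X.obj (ofModel s)) (g : ofModel s ⟶ a) (g' : ofModel s ⟶ c),
      t = cover.mk v g ∧ t' = cover.mk v g' := by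
  have h' : CoverElt.of t.elt (t.hom ≫ f) = CoverElt.of t'.elt (t'.hom ≫ f') := h
  rw [CoverElt.of, CoverElt.of, CoverElt.mk.injEq] at h'
  exact CoverElt.exists_eq_of t t' h'.1 h'.2.1

/-- The projection from the cover. -/
def cover.π (X : 𝒜 ⥤ Type w) : cover X ⟶ X where
  app b := ↾fun t => X.map t.hom t.elt
  naturality b c f := by
    ext t
    exact (congrArg (fun g => X.map g (CoverElt.elt t)) (CoverElt.hom_of (CoverElt.elt t) (CoverElt.hom t ≫ f))).trans
      (type_map_comp_apply X _ _ _)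

lemma cover.π_mk {s : SmallModel.{w} 𝒜} (v : X.obj (ofModel s)) {b : 𝒜} (g : ofModel s ⟶ b) :
    (cover.π X).app b (cover.mk v g) = X.map g v :=
  congrArg (fun g => X.map g v) (CoverElt.hom_of _ _)

lemma cover.π_surjective (b : 𝒜) : Function.Surjective ((cover.π X).app b) := fun y => by
  obtain ⟨s, ⟨e⟩⟩ := exists_ofModel_iso.{w} b
  exact ⟨cover.mk (X.map e.inv y) e.hom, by rw [cover.π_mk, ← type_map_comp_apply, e.inv_hom_id,
    type_map_id_apply]⟩

/-- The Yoneda lemma: a lift is determined by free choices at the identity of each representable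
summand. -/
instance (k : Type w) [Field k] (X : 𝒜 ⥤ Type w) : Projective (lin k (cover X)) where
  factors {E F} φ q hq := by
    have hq' := (FunRep.epi_iff q).1 hq
    choose z hz using fun (s : SmallModel.{w} 𝒜) (v : X.obj (ofModel s)) =>
      hq' _ ((φ.app (ofModel s)).hom (pt k (cover.mk v (𝟙 _))))
    let ψ (b : 𝒜) (t : (cover X).obj b) : E.obj b :=
      (E.map (CoverElt.hom t)).hom (z (CoverElt.source t) (CoverElt.elt t))
    have hψ {s : SmallModel.{w} 𝒜} (v : X.obj (ofModel s)) {b : 𝒜} (g : ofModel s ⟶ b) :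
        ψ b (cover.mk v g) = (E.map g).hom (z s v) :=
      congrArg (fun g => (E.map g).hom (z s v)) (CoverElt.hom_of v g)
    refine ⟨linDesc ψ fun {a b} f t => ?_, lin_hom_ext fun b t => ?_⟩
    · obtain ⟨s, v, g, rfl⟩ := cover.exists_eq_mk t
      rw [cover.map_mk, hψ, hψ, Functor.map_comp]
      rfl
    · refine (congrArg (q.app b).hom (linDesc_pt _ _ t)).trans ?_
      obtain ⟨s, v, g, rfl⟩ := cover.exists_eq_mk t
      rw [hψ, FunRep.naturality_apply, hz, ← app_pt_naturality, cover.map_mk, Category.id_comp]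

end Cover

/-! ### Fibrewise additive functors to sets -/

variable [Preadditive 𝒜] [HasFiniteBiproducts 𝒜]

attribute [local instance] hasBinaryBiproducts_of_finite_biproducts

/-- Two elements lie in the same component if they have the same image under zero morphisms. -/
def SameComponent (X : 𝒜 ⥤ Type w) {a c : 𝒜} (v : X.obj a) (y : X.obj c) : Prop :=
  ∀ e : 𝒜, X.map (0 : a ⟶ e) v = X.map (0 : c ⟶ e) y

/-- A functor to sets is fibrewise additive if it is a disjoint union of product-preserving
functors. -/
structure IsFiberAdditive (X : 𝒜 ⥤ Type w) : Prop where
  exists_lift {a c : 𝒜} (v : X.obj a) (y : X.obj c) (h : SameComponent X v y) :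
    ∃ t : X.obj (a ⊞ c), X.map biprod.fst t = v ∧ X.map biprod.snd t = y
  ext {a c : 𝒜} {t t' : X.obj (a ⊞ c)} (h₁ : X.map biprod.fst t = X.map biprod.fst t')
    (h₂ : X.map biprod.snd t = X.map biprod.snd t') : t = t'

/-- Each component of `X` preserves products, so morphisms of `𝒜` can be subtracted inside it: `(f,
g)` and `(g, g)` agree on `v`, and the difference map is applied to both. The element `X.map 0 v`
plays the role of zero in the component of `v`. -/
lemma IsFiberAdditive.map_sub {X : 𝒜 ⥤ Type w} (hX : IsFiberAdditive X) {x a : 𝒜} (f g : x ⟶ a)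
    (v : X.obj x) (h : X.map f v = X.map g v) : X.map (f - g) v = X.map (0 : x ⟶ a) v := by
  have h1 : X.map (biprod.lift f g) v = X.map (biprod.lift g g) v := by
    apply hX.ext <;> simp only [← type_map_comp_apply, biprod.lift_fst, biprod.lift_snd, h]
  have h2 := congrArg (X.map (biprod.desc (𝟙 a) (-𝟙 a))) h1
  rw [← type_map_comp_apply, ← type_map_comp_apply] at h2
  simpa [biprod.lift_desc, sub_eq_add_neg] using h2

lemma cover.isFiberAdditive [EssentiallySmall.{w} 𝒜] (X : 𝒜 ⥤ Type w) : IsFiberAdditive (cover X) where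
  exists_lift {a c} t t' h := by
    obtain ⟨s, v, g, g', rfl, rfl⟩ := cover.exists_eq_mk_of_map_eq t t' _ _ (h a)
    exact ⟨cover.mk v (biprod.lift g g'), by rw [cover.map_mk, biprod.lift_fst],
      by rw [cover.map_mk, biprod.lift_snd]⟩
  ext {a c} t t' h₁ h₂ := by
    obtain ⟨s, v, g, g', rfl, rfl⟩ := cover.exists_eq_mk_of_map_eq t t' _ _ h₁
    rw [cover.map_mk, cover.map_mk] at h₁ h₂
    exact congrArg (cover.mk v) (biprod.hom_ext _ _ (cover.mk_injective v h₁)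
      (cover.mk_injective v h₂))

end

section

/-! ### The Čech resolution of a cover -/

section Cech

variable {𝒜 : Type u} [Category.{v} 𝒜] {k : Type w} [Field k] {P X : 𝒜 ⥤ Type w} (π : P ⟶ X)

lemma type_naturality_apply {a b : 𝒜} (f : a ⟶ b) (t : P.obj a) :
    π.app b (P.map f t) = X.map f (π.app a t) := congr($(π.naturality f) t)

/-- The `p`-th fibre power of `P` over `X`. -/
def cech (p : ℕ) : 𝒜 ⥤ Type w where
  obj a := {y : X.obj a × (Fin p → P.obj a) // ∀ i, π.app a (y.2 i) = y.1}
  map f := ↾fun y => ⟨(X.map f y.1.1, fun i => P.map f (y.1.2 i)), fun i =>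
    (type_naturality_apply π f _).trans (congrArg (X.map f) (y.2 i))⟩
  map_id _ := ConcreteCategory.hom_ext _ _ fun _ => Subtype.ext
    (Prod.ext (type_map_id_apply X _) (funext fun _ => type_map_id_apply P _))
  map_comp _ _ := ConcreteCategory.hom_ext _ _ fun _ => Subtype.ext
    (Prod.ext (type_map_comp_apply X _ _ _) (funext fun _ => type_map_comp_apply P _ _ _))

variable {π}

/-- The underlying element of `X`. -/
def cech.base {p : ℕ} {a : 𝒜} (y : (cech π p).obj a) : X.obj a := y.1.1

/-- The components of an element of a fibre power. -/
def cech.comp {p : ℕ} {a : 𝒜} (y : (cech π p).obj a) (i : Fin p) : P.obj a := y.1.2 i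

lemma cech.π_comp {p : ℕ} {a : 𝒜} (y : (cech π p).obj a) (i : Fin p) :
    π.app a (cech.comp y i) = cech.base y := y.2 i

lemma cech.ext {p : ℕ} {a : 𝒜} {y z : (cech π p).obj a} (h : cech.base y = cech.base z)
    (h' : ∀ i, cech.comp y i = cech.comp z i) : y = z :=
  Subtype.ext (Prod.ext h (funext h'))

/-- Adding a component in front. -/
def cech.cons {p : ℕ} {a : 𝒜} (t : P.obj a) (y : (cech π p).obj a)
    (h : π.app a t = cech.base y) : (cech π (p + 1)).obj a :=
  ⟨(cech.base y, Fin.cons t (cech.comp y)), fun i => by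
    refine Fin.cases ?_ (fun i => ?_) i
    · exact h
    · exact cech.π_comp y i⟩

lemma cech.map_cons {p : ℕ} {a b : 𝒜} (f : a ⟶ b) (t : P.obj a) (y : (cech π p).obj a)
    (h : π.app a t = cech.base y) :
    (cech π (p + 1)).map f (cech.cons t y h) = cech.cons (P.map f t) ((cech π p).map f y)
      ((type_naturality_apply π f t).trans (congrArg _ h)) :=
  cech.ext rfl fun i => by refine Fin.cases rfl (fun i => rfl) i

/-- Omitting a component. -/
def cech.face {p : ℕ} {a : 𝒜} (i : Fin (p + 1)) (y : (cech π (p + 1)).obj a) :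
    (cech π p).obj a :=
  ⟨(cech.base y, fun j => cech.comp y (i.succAbove j)), fun _ => cech.π_comp y _⟩

lemma cech.map_face {p : ℕ} {a b : 𝒜} (f : a ⟶ b) (i : Fin (p + 1))
    (y : (cech π (p + 1)).obj a) :
    (cech π p).map f (cech.face i y) = cech.face i ((cech π (p + 1)).map f y) := rfl

lemma cech.face_zero_cons {p : ℕ} {a : 𝒜} (t : P.obj a) (y : (cech π p).obj a)
    (h : π.app a t = cech.base y) : cech.face 0 (cech.cons t y h) = y :=
  cech.ext rfl fun _ => rfl

lemma cech.face_succ_cons {p : ℕ} {a : 𝒜} (t : P.obj a) (y : (cech π (p + 1)).obj a)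
    (h : π.app a t = cech.base y) (i : Fin (p + 1)) :
    cech.face i.succ (cech.cons t y h) = cech.cons t (cech.face i y) h :=
  cech.ext rfl fun j => by
    refine Fin.cases rfl (fun j => ?_) j
    exact congrArg (cech.comp (cech.cons t y h)) (Fin.succ_succAbove_succ i j)

lemma cech.cons_comp_zero {p : ℕ} {a : 𝒜} (y : (cech π (p + 1)).obj a) :
    cech.cons (cech.comp y 0) (cech.face 0 y) (cech.π_comp y 0) = y :=
  cech.ext rfl fun j => by refine Fin.cases rfl (fun j => rfl) j

variable (k π)

/-- The differential of the Čech resolution. -/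
def cechD (p : ℕ) : lin k (cech π (p + 1)) ⟶ lin k (cech π p) :=
  linDesc (fun _ y => ∑ i : Fin (p + 1), ((-1 : k) ^ (i : ℕ)) • pt k (cech.face i y))
    fun f y => by
      rw [map_sum]
      refine Finset.sum_congr rfl fun i _ => ?_
      rw [map_smul, lin_map_pt, cech.map_face]

lemma cechD_pt {p : ℕ} {a : 𝒜} (y : (cech π (p + 1)).obj a) : ((cechD k π p).app a).hom (pt k y) =
    ∑ i : Fin (p + 1), ((-1 : k) ^ (i : ℕ)) • pt k (cech.face i y) :=
  linMapDesc_pt _ _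

variable {π}

/-- The contracting homotopy given by a section of `π`. -/
def cechH (p : ℕ) {a : 𝒜} (σ : X.obj a → P.obj a) (hσ : ∀ v, π.app a (σ v) = v) :
    (lin k (cech π p)).obj a →ₗ[k] (lin k (cech π (p + 1))).obj a :=
  linMapDesc fun y => pt k (cech.cons (σ (cech.base y)) y (hσ _))

variable {k}
variable {a : 𝒜} (σ : X.obj a → P.obj a) (hσ : ∀ v, π.app a (σ v) = v)

lemma cechH_pt {p : ℕ} (y : (cech π p).obj a) :
    cechH k p σ hσ (pt k y) = pt k (cech.cons (σ (cech.base y)) y (hσ _)) :=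
  linMapDesc_pt _ _

lemma cechD_cechH_zero (z : (lin k (cech π 0)).obj a) :
    ((cechD k π 0).app a).hom (cechH k 0 σ hσ z) = z := by
  have h : ((cechD k π 0).app a).hom ∘ₗ cechH k 0 σ hσ = LinearMap.id := linMap_ext fun y => by
    rw [LinearMap.comp_apply, cechH_pt, cechD_pt, Fin.sum_univ_one, cech.face_zero_cons,
      Fin.val_zero, pow_zero, one_smul]
    rfl
  exact congr($h z)

lemma cechD_cechH {p : ℕ} (z : (lin k (cech π (p + 1))).obj a) :
    ((cechD k π (p + 1)).app a).hom (cechH k (p + 1) σ hσ z) =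
      z - cechH k p σ hσ (((cechD k π p).app a).hom z) := by
  have h : ((cechD k π (p + 1)).app a).hom ∘ₗ cechH k (p + 1) σ hσ =
      LinearMap.id - cechH k p σ hσ ∘ₗ ((cechD k π p).app a).hom := linMap_ext fun y => by
    rw [LinearMap.comp_apply, cechH_pt, cechD_pt, Fin.sum_univ_succ, cech.face_zero_cons,
      LinearMap.sub_apply, LinearMap.comp_apply, cechD_pt, map_sum, sub_eq_add_neg,
      ← Finset.sum_neg_distrib]
    congr 1
    · rw [Fin.val_zero, pow_zero, one_smul]
      rfl
    · refine Finset.sum_congr rfl fun i _ => ?_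
      rw [map_smul, cechH_pt, cech.face_succ_cons, Fin.val_succ, pow_succ, mul_neg_one, neg_smul]
      rfl
  exact congr($h z)

/-- A section adapted to `t` makes any given basis element of the Čech complex lie in the image of a
contracting homotopy. -/
lemma exists_section (hπ : Function.Surjective (π.app a)) (t : P.obj a) :
    ∃ σ : X.obj a → P.obj a, (∀ v, π.app a (σ v) = v) ∧ σ (π.app a t) = t := by
  classical
  refine ⟨Function.update (Function.surjInv hπ) (π.app a t) t, fun v => ?_,
    Function.update_self _ _ _⟩
  by_cases h : v = π.app a t
  · rw [h, Function.update_self]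
  · rw [Function.update_of_ne h]
    exact Function.surjInv_eq hπ v

lemma exists_cechH_pt_eq (hπ : Function.Surjective (π.app a)) {p : ℕ}
    (y : (cech π (p + 1)).obj a) : ∃ (σ : X.obj a → P.obj a) (hσ : ∀ v, π.app a (σ v) = v),
      cechH k p σ hσ (pt k (cech.face 0 y)) = pt k y := by
  obtain ⟨σ, hσ, h⟩ := exists_section hπ (cech.comp y 0)
  refine ⟨σ, hσ, ?_⟩
  rw [cechH_pt]
  congr 1
  conv_rhs => rw [← cech.cons_comp_zero y]
  rw [cech.π_comp] at h
  congr 1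

/-- With the homotopy `h` adapted to a basis element `y = h(z)`, the identity `d h = 1 - h d` gives
`d d y = h d d z`, and induction replaces the usual cancellation of pairs of faces. -/
lemma cechD_cechD (hπ : Function.Surjective (π.app a)) (p : ℕ)
    (z : (lin k (cech π (p + 2))).obj a) :
    ((cechD k π p).app a).hom (((cechD k π (p + 1)).app a).hom z) = 0 := by
  induction p with
  | zero =>
    induction z using lin_induction with
    | zero => simp only [map_zero]
    | add x y hx hy => rw [map_add, map_add, hx, hy, add_zero]
    | smul r x hx => rw [map_smul, map_smul, hx, smul_zero]
    | pt y =>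
      obtain ⟨σ, hσ, h⟩ := exists_cechH_pt_eq (k := k) hπ y
      rw [← h, cechD_cechH, map_sub, cechD_cechH_zero, sub_self]
  | succ p ih =>
    induction z using lin_induction with
    | zero => simp only [map_zero]
    | add x y hx hy => rw [map_add, map_add, hx, hy, add_zero]
    | smul r x hx => rw [map_smul, map_smul, hx, smul_zero]
    | pt y =>
      obtain ⟨σ, hσ, h⟩ := exists_cechH_pt_eq (k := k) hπ y
      rw [← h, cechD_cechH, map_sub, cechD_cechH, ih, map_zero, sub_zero, sub_self]

end Cech

lemma FunRep.comp_apply {𝒜 : Type u} [Category.{v} 𝒜] {k : Type w} [Field k] {F G H : FunRep k 𝒜}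
    (φ : F ⟶ G) (ψ : G ⟶ H) {a : 𝒜} (x : F.obj a) :
    ((φ ≫ ψ).app a).hom x = (ψ.app a).hom ((φ.app a).hom x) := rfl

/-! ### Means -/

section Mean

variable {𝒜 : Type u} [Category.{v} 𝒜] {k : Type w} [Field k] {P X : 𝒜 ⥤ Type w} (π : P ⟶ X)

/-- A morphism `f` out of `a` together with a lift to `P` of the image by `f` of `v`. -/
structure LiftIdx {a : 𝒜} (v : X.obj a) where
  /-- The target of the morphism. -/
  target : 𝒜
  /-- The morphism. -/
  hom : a ⟶ target
  /-- The lift. -/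
  lift : P.obj target
  π_lift : π.app target lift = X.map hom v

variable {π}

/-- Postcomposition. -/
def LiftIdx.push {a : 𝒜} {v : X.obj a} (i : LiftIdx π v) {c : 𝒜} (g : i.target ⟶ c) :
    LiftIdx π v :=
  ⟨c, i.hom ≫ g, P.map g i.lift, by
    rw [type_naturality_apply, i.π_lift, type_map_comp_apply]⟩

/-- Precomposition. -/
def LiftIdx.pull {a b : 𝒜} (f : a ⟶ b) {v : X.obj a} (i : LiftIdx π (X.map f v)) :
    LiftIdx π v :=
  ⟨i.target, f ≫ i.hom, i.lift, by rw [i.π_lift, type_map_comp_apply]⟩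

variable (π) (F : FunRep k 𝒜)

/-- The natural families of elements of `F` indexed by the lifts to `P` of the images of `v`. -/
def Family {a : 𝒜} (v : X.obj a) : Submodule k (∀ i : LiftIdx π v, F.obj i.target) where
  carrier := {θ | ∀ (i : LiftIdx π v) (c : 𝒜) (g : i.target ⟶ c),
    θ (i.push g) = (F.map g).hom (θ i)}
  zero_mem' _ _ _ := (map_zero _).symm
  add_mem' h h' i c g := (congrArg₂ (· + ·) (h i c g) (h' i c g)).trans (map_add _ _ _).symm
  smul_mem' r _ h i c g := (congrArg (r • ·) (h i c g)).trans (map_smul _ _ _).symm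

variable {π F}

/-- The family induced by an element of `F`. -/
def Family.const {a : 𝒜} (v : X.obj a) (z : F.obj a) : Family π F v :=
  ⟨fun i => (F.map i.hom).hom z, fun i _ g => congr(($(F.map_comp i.hom g)).hom z)⟩

lemma Family.congr {a : 𝒜} {v : X.obj a} (θ : Family π F v) (c : 𝒜) {f f' : a ⟶ c} (hf : f = f')
    {t t' : P.obj c} (ht : t = t') (h : π.app c t = X.map f v) (h' : π.app c t' = X.map f' v) :
    θ.1 ⟨c, f, t, h⟩ = θ.1 ⟨c, f', t', h'⟩ := by
  subst hf ht
  rfl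

/-- The restriction of a family along a morphism. -/
def Family.restrict {a b : 𝒜} (f : a ⟶ b) {v : X.obj a} (θ : Family π F v) :
    Family π F (X.map f v) :=
  ⟨fun i => θ.1 i.pull, fun i c g => by
    refine Eq.trans ?_ (θ.2 i.pull c g)
    exact Family.congr θ _ (Category.assoc _ _ _).symm rfl _ _⟩

variable (π F)

/-- A natural way to average the natural families of elements of `F`. -/
structure Mean where
  /-- The mean of a family. -/
  val {a : 𝒜} (v : X.obj a) : Family π F v →ₗ[k] F.obj a
  map_val {a b : 𝒜} (f : a ⟶ b) (v : X.obj a) (θ : Family π F v) :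
    (F.map f).hom (val v θ) = val (X.map f v) (Family.restrict f θ)
  val_const {a : 𝒜} (v : X.obj a) (z : F.obj a) : val v (Family.const v z) = z

variable {π F}

/-- The family of values of a morphism on the elements obtained by adding a component. -/
def consFamily {p : ℕ} (φ : lin k (cech π (p + 1)) ⟶ F) {a : 𝒜} (y : (cech π p).obj a) :
    Family π F (cech.base y) :=
  ⟨fun i => (φ.app i.target).hom (pt k (cech.cons i.lift ((cech π p).map i.hom y) i.π_lift)),
    fun i c g => by
      refine Eq.trans ?_ (app_pt_naturality φ g _)
      refine congrArg (fun z => (φ.app c).hom (pt k z)) (Eq.trans ?_ (cech.map_cons _ _ _ _).symm)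
      refine cech.ext ?_ fun j => ?_
      · exact type_map_comp_apply X _ _ _
      · refine Fin.cases rfl (fun j => ?_) j
        exact type_map_comp_apply P _ _ _⟩

lemma cech.hom_pt_eq_sum {p : ℕ} (φ : lin k (cech π (p + 1)) ⟶ F)
    (hφ : cechD k π (p + 1) ≫ φ = 0) {a : 𝒜} (t : P.obj a) (y : (cech π (p + 1)).obj a)
    (h : π.app a t = cech.base y) : (φ.app a).hom (pt k y) = ∑ i : Fin (p + 1),
      (-1 : k) ^ (i : ℕ) • (φ.app a).hom (pt k (cech.cons t (cech.face i y) h)) := by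
  have h := congr((ModuleCat.Hom.hom (NatTrans.app $hφ a)) (pt k (cech.cons t y h)))
  rw [FunRep.comp_apply, cechD_pt, Fin.sum_univ_succ, cech.face_zero_cons, Fin.val_zero,
    pow_zero, one_smul, map_add, map_sum] at h
  refine (eq_neg_of_add_eq_zero_left h).trans ?_
  rw [← Finset.sum_neg_distrib]
  refine Finset.sum_congr rfl fun j _ => ?_
  rw [cech.face_succ_cons, map_smul, Fin.val_succ, pow_succ, mul_neg_one, neg_smul, neg_neg]

lemma Mean.exists_comp_eq (m : Mean π F) {p : ℕ}
    (φ : lin k (cech π (p + 1)) ⟶ F) (hφ : cechD k π (p + 1) ≫ φ = 0) :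
    ∃ χ : lin k (cech π p) ⟶ F, cechD k π p ≫ χ = φ := by
  -- The usual homotopy adds a chosen component in front; no natural choice exists, so the values
  -- over all choices are averaged. By the cocycle identity `cech.hom_pt_eq_sum`, the family to be
  -- averaged for the coboundary is the constant one given by `φ y`.
  refine ⟨linDesc (fun _ y => m.val _ (consFamily φ y)) fun {a b} f y => ?_,
    lin_hom_ext fun a y => ?_⟩
  · rw [m.map_val]
    congr 1
    refine Subtype.ext (funext fun i => ?_)
    change (φ.app _).hom (pt k _) = (φ.app _).hom (pt k _)
    congr 2
    refine cech.ext ?_ fun j => ?_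
    · exact (type_map_comp_apply X _ _ _).symm
    · refine Fin.cases rfl (fun j => ?_) j
      exact (type_map_comp_apply P _ _ _).symm
  · rw [FunRep.comp_apply, cechD_pt, map_sum]
    simp only [map_smul, linDesc_pt]
    refine Eq.trans ?_ (m.val_const (cech.base y) ((φ.app a).hom (pt k y)))
    let Θ (i : Fin (p + 1)) : Family π F (cech.base y) := consFamily φ (cech.face i y)
    change ∑ i : Fin (p + 1), (-1 : k) ^ (i : ℕ) • m.val (cech.base y) (Θ i) = _
    simp only [← map_smul, ← map_sum]
    refine congrArg _ (Subtype.ext (funext fun i => ?_))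
    refine Eq.trans ?_ ((cech.hom_pt_eq_sum φ hφ i.lift ((cech π (p + 1)).map i.hom y)
      i.π_lift).symm.trans (app_pt_naturality φ i.hom y))
    rw [Submodule.coe_sum, Finset.sum_apply]
    rfl

end Mean

/-! ### Acyclicity of linearised fibrewise additive functors -/

section Vanishing

universe t

variable {𝒜 : Type u} [Category.{v} 𝒜] [Preadditive 𝒜] [HasFiniteBiproducts 𝒜]

attribute [local instance] hasBinaryBiproducts_of_finite_biproducts

lemma IsFiberAdditive.cech {P X : 𝒜 ⥤ Type w} (hP : IsFiberAdditive P) (hX : IsFiberAdditive X)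
    (π : P ⟶ X) (p : ℕ) : IsFiberAdditive (cech π p) where
  exists_lift {a c} y y' h := by
    obtain ⟨v, hv, hv'⟩ := hX.exists_lift (cech.base y) (cech.base y')
      fun e => congrArg cech.base (h e)
    choose t ht ht' using fun i => hP.exists_lift (cech.comp y i) (cech.comp y' i)
      fun e => congrArg (fun y => cech.comp y i) (h e)
    refine ⟨⟨(v, t), fun i => hX.ext ?_ ?_⟩, cech.ext hv ht, cech.ext hv' ht'⟩
    · rw [← type_naturality_apply, ht, hv, cech.π_comp]
    · rw [← type_naturality_apply, ht', hv', cech.π_comp]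
  ext {a c} y y' h h' := cech.ext (hX.ext (congrArg cech.base h) (congrArg cech.base h'))
    fun i => hP.ext (congrArg (fun y => cech.comp y i) h) (congrArg (fun y => cech.comp y i) h')

variable {k : Type w} [Field k] {P X : 𝒜 ⥤ Type w}

/-- The zeroth fibre power is the base. -/
def cechZeroIso (π : P ⟶ X) : cech π 0 ≅ X :=
  NatIso.ofComponents (fun _ => Equiv.toIso
    { toFun y := cech.base y
      invFun v := ⟨(v, Fin.elim0), fun i => i.elim0⟩
      left_inv _ := cech.ext rfl fun i => i.elim0
      right_inv _ := rfl }) fun _ => rfl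

/-- The first fibre power is the covering functor. -/
def cechOneIso (π : P ⟶ X) : cech π 1 ≅ P :=
  NatIso.ofComponents (fun a => Equiv.toIso
    { toFun y := cech.comp y 0
      invFun t := ⟨(π.app a t, fun _ => t), fun _ => rfl⟩
      left_inv y := cech.ext (cech.π_comp y 0)
        fun _ => congrArg (cech.comp y) (Subsingleton.elim _ _)
      right_inv _ := rfl }) fun _ => rfl

/-- The isomorphism of linearisations induced by an isomorphism. -/
def linIso (k : Type w) [Field k] (e : P ≅ X) : lin k P ≅ lin k X :=
  Functor.isoWhiskerRight e (ModuleCat.free k)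

-- Strong induction on the degree, simultaneous for all `X`. In the Čech resolution of `X` by
-- representables, the term next to `k[X]` is projective and the others are again linearisations of
-- fibrewise additive functors, needed only in lower degrees. The mean makes the complex of
-- morphisms exact.
open Abelian in
theorem subsingleton_ext_lin [EssentiallySmall.{w} 𝒜] [HasExt.{t} (FunRep k 𝒜)] (F : FunRep k 𝒜)
    (hF : ∀ X : 𝒜 ⥤ Type w, IsFiberAdditive X → Nonempty (Mean (cover.π X) F)) (n : ℕ)
    (X : 𝒜 ⥤ Type w) (hX : IsFiberAdditive X) : Subsingleton (Ext (lin k X) F (n + 1)) := by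
  induction n using Nat.strong_induction_on generalizing X with
  | h n ih =>
  have hπ := cover.π_surjective (X := X)
  have hS (a : 𝒜) : ∃ σ : X.obj a → (cover X).obj a, ∀ v, (cover.π X).app a (σ v) = v :=
    ⟨_, Function.surjInv_eq (hπ a)⟩
  have : Epi (cechD k (cover.π X) 0) := (FunRep.epi_iff _).2 fun a z => by
    obtain ⟨σ, hσ⟩ := hS a
    exact ⟨_, cechD_cechH_zero σ hσ z⟩
  have hd (p : ℕ) : cechD k (cover.π X) (p + 1) ≫ cechD k (cover.π X) p = 0 :=
    NatTrans.ext (funext fun a => ModuleCat.hom_ext (LinearMap.ext fun z =>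
      cechD_cechD (hπ a) p z))
  have ex (p : ℕ) : (ShortComplex.mk _ _ (hd p)).Exact :=
    (FunRep.exact_iff _).2 fun a z hz => by
      obtain ⟨σ, hσ⟩ := hS a
      refine ⟨cechH k (p + 1) σ hσ z, (cechD_cechH σ hσ z).trans ?_⟩
      rw [show ((cechD k (cover.π X) p).app a).hom z = 0 from hz, map_zero, sub_zero]
  refine subsingleton_ext_of_iso (linIso k (cechZeroIso (cover.π X))) F (n + 1)
    (subsingleton_ext_of_resolution n _ (fun p => lin k (cech (cover.π X) (p + 1)))
      (cechD k _ 0) (fun p => cechD k _ (p + 1)) (hd 0) (fun p => hd (p + 1)) (ex 0)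
      (fun p => ex (p + 1)) (fun p φ hφ => ?_) fun p i hpi => ?_)
  · obtain ⟨m⟩ := hF X hX
    exact m.exists_comp_eq φ hφ
  · cases p with
    | zero =>
      have : Projective (lin k (cech (cover.π X) 1)) :=
        Projective.of_iso (linIso k (cechOneIso (cover.π X))).symm inferInstance
      exact Ext.subsingleton_of_projective _ _ _
    | succ p =>
      exact ih i (by omega) _ ((cover.isFiberAdditive X).cech hX _ _)

end Vanishing

end

section

open scoped MonoidAlgebra

/-! ### Generalised limits with values in an injective module -/

/-- An invariant linear functional on families of elements of `V`, extending the evaluation of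
eventually constant families. -/
structure GenLim {k : Type*} [Field k] {G : Type*} [Group G] (V : Rep.{w} k G) {D : Type*}
    (l : Filter D) where
  /-- The functional. -/
  lim : (D → V) →ₗ[k] V
  lim_ρ (g : G) (h : D → V) : lim (fun d => V.ρ g (h d)) = V.ρ g (lim h)
  lim_const (j : V) : lim (fun _ => j) = j
  lim_congr {h h' : D → V} (e : h =ᶠ[l] h') : lim h = lim h'

lemma nonempty_genLim {k : Type*} [Field k] {G : Type*} [Group G] [Small.{w} k[G]]
    (J : ModuleCat.{w} k[G]) [Injective J] {D : Type*} (l : Filter D) [l.NeBot] :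
    Nonempty (GenLim (Rep.ofModuleMonoidAlgebra.obj J) l) := by
  have : Module.Injective k[G] J := Module.injective_module_of_injective_object _ _
  let c : J →ₗ[k[G]] l.Germ J :=
    { toFun j := (j : l.Germ J)
      map_add' _ _ := rfl
      map_smul' _ _ := rfl }
  -- Constant families embed `J` in the module of germs because the filter is proper; injectivity
  -- gives a linear retraction, which serves as the limit.
  obtain ⟨r, hr⟩ := Module.Injective.extension_property k[G] J J (l.Germ J) c
    (fun _ _ h => Filter.Germ.const_inj.1 h) LinearMap.id
  let q : (D → J) →ₗ[k[G]] l.Germ J :=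
    { toFun h := (h : l.Germ J)
      map_add' _ _ := rfl
      map_smul' _ _ := rfl }
  exact ⟨{
    lim :=
      { toFun h := r (q h)
        map_add' h h' := (congrArg r (q.map_add h h')).trans (r.map_add _ _)
        map_smul' x h := (congrArg r (q.map_smul (algebraMap k k[G] x) h)).trans
          (r.map_smul _ _) }
    lim_ρ g h := (congrArg r (q.map_smul (MonoidAlgebra.single g 1) h)).trans (r.map_smul _ _)
    lim_const j := congr($hr j)
    lim_congr e := congrArg r (Filter.Germ.coe_eq.2 e) }⟩

/-! ### The mean on the functors `Q_{B, V}` -/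

section

universe t

variable {𝒜 : Type u} [Category.{v} 𝒜] [Preadditive 𝒜]

lemma SameComponent.map {X : 𝒜 ⥤ Type w} {a c : 𝒜} (v : X.obj a) (f : a ⟶ c) :
    SameComponent X v (X.map f v) := fun e => by
  rw [← type_map_comp_apply, comp_zero]

lemma SameComponent.symm {X : 𝒜 ⥤ Type w} {a c : 𝒜} {v : X.obj a} {y : X.obj c}
    (h : SameComponent X v y) : SameComponent X y v := fun e => (h e).symm

lemma SameComponent.trans {X : 𝒜 ⥤ Type w} {a b c : 𝒜} {v : X.obj a} {y : X.obj b} {z : X.obj c}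
    (h : SameComponent X v y) (h' : SameComponent X y z) : SameComponent X v z :=
  fun e => (h e).trans (h' e)

variable [HasFiniteBiproducts 𝒜] [EssentiallySmall.{w} 𝒜]

attribute [local instance] hasBinaryBiproducts_of_finite_biproducts

/-- An element of `X` together with a morphism identifying it with zero. -/
structure LimIdx (X : 𝒜 ⥤ Type w) where
  /-- The object supporting the element. -/
  source : SmallModel.{w} 𝒜
  /-- The element. -/
  elt : X.obj (ofModel source)
  /-- The target of the morphism. -/
  target : 𝒜
  /-- The morphism. -/
  hom : ofModel source ⟶ target
  map_hom : X.map hom elt = X.map 0 elt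

variable {X : 𝒜 ⥤ Type w}

/-- The filter along which means are computed: the elements in a given component become more and
more general, and the morphisms identifying them with zero more and more universal. -/
def limFilter (hX : IsFiberAdditive X) {a : 𝒜} (v : X.obj a) : Filter (LimIdx X) where
  sets := {S | ∃ (x₀ : 𝒜) (v₀ : X.obj x₀), SameComponent X v v₀ ∧
    ∀ (s : SmallModel.{w} 𝒜) (v₁ : X.obj (ofModel s)) (g : ofModel s ⟶ x₀), X.map g v₁ = v₀ →
      ∃ (c₀ : 𝒜) (r₀ : ofModel s ⟶ c₀), X.map r₀ v₁ = X.map 0 v₁ ∧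
        ∀ (c : 𝒜) (r : ofModel s ⟶ c) (hr : X.map r v₁ = X.map 0 v₁), (∃ h, r ≫ h = r₀) →
          ⟨s, v₁, c, r, hr⟩ ∈ S}
  univ_sets := ⟨a, v, fun _ => rfl, fun s v₁ g _ =>
    ⟨ofModel s, 0, rfl, fun _ _ _ _ => trivial⟩⟩
  sets_of_superset := by
    rintro S T ⟨x₀, v₀, h₀, h⟩ hST
    refine ⟨x₀, v₀, h₀, fun s v₁ g hg => ?_⟩
    obtain ⟨c₀, r₀, hr₀, h⟩ := h s v₁ g hg
    exact ⟨c₀, r₀, hr₀, fun c r hr hh => hST (h c r hr hh)⟩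
  inter_sets := by
    rintro S T ⟨x₀, v₀, h₀, h⟩ ⟨x₀', v₀', h₀', h'⟩
    -- Elements of one component form a directed system, since any two are projections of one
    -- element; below, the relations `r₀` and `r₀'` are combined in the same way.
    obtain ⟨t, ht, ht'⟩ := hX.exists_lift v₀ v₀' (h₀.symm.trans h₀')
    refine ⟨x₀ ⊞ x₀', t, h₀.trans ?_, fun s v₁ g hg => ?_⟩
    · rw [← ht]
      exact (SameComponent.map t _).symm
    · obtain ⟨c₀, r₀, hr₀, h⟩ := h s v₁ (g ≫ biprod.fst) (by rw [type_map_comp_apply, hg, ht])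
      obtain ⟨c₀', r₀', hr₀', h'⟩ :=
        h' s v₁ (g ≫ biprod.snd) (by rw [type_map_comp_apply, hg, ht'])
      refine ⟨c₀ ⊞ c₀', biprod.lift r₀ r₀', hX.ext ?_ ?_, ?_⟩
      · rw [← type_map_comp_apply, ← type_map_comp_apply, biprod.lift_fst, hr₀, zero_comp]
      · rw [← type_map_comp_apply, ← type_map_comp_apply, biprod.lift_snd, hr₀', zero_comp]
      · rintro c r hr ⟨q, hq⟩
        exact ⟨h c r hr ⟨q ≫ biprod.fst, by rw [← Category.assoc, hq, biprod.lift_fst]⟩,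
          h' c r hr ⟨q ≫ biprod.snd, by rw [← Category.assoc, hq, biprod.lift_snd]⟩⟩

instance (hX : IsFiberAdditive X) {a : 𝒜} (v : X.obj a) : (limFilter hX v).NeBot := by
  refine Filter.neBot_iff.2 fun hbot => ?_
  obtain ⟨x₀, v₀, -, h⟩ := Filter.empty_mem_iff_bot.2 hbot
  obtain ⟨s, ⟨e⟩⟩ := exists_ofModel_iso.{w} x₀
  obtain ⟨c₀, r₀, hr₀, h⟩ := h s (X.map e.inv v₀) e.hom
    (by rw [← type_map_comp_apply, e.inv_hom_id, type_map_id_apply])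
  exact h c₀ r₀ hr₀ ⟨𝟙 _, Category.comp_id _⟩

/-- The filter sees only the component of `v`, so one and the same limit functional can be used
along all morphisms. -/
lemma limFilter_map (hX : IsFiberAdditive X) {a b : 𝒜} (f : a ⟶ b) (v : X.obj a) :
    limFilter hX (X.map f v) = limFilter hX v := by
  refine Filter.ext fun S => exists_congr fun x₀ => exists_congr fun v₀ => and_congr_left' ?_
  exact ⟨(SameComponent.map v f).trans, (SameComponent.map v f).symm.trans⟩

variable {k : Type w} [Field k] {B : AddRep.{w} 𝒜}

/-- The functor `Q_{B, V}`, for a representation `V` of `Aut B`. -/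
abbrev QRep (V : Rep.{w} k (Aut B)) : FunRep k 𝒜 :=
  QA k B ⋙ (Rep.coinvariantsTensor k (Aut B)).obj V

variable {V : Rep.{w} k (Aut B)}

/-- As `d.hom` sends `d.elt` to zero, the pair `(g, d.hom)` lifts the inclusion of `g(d.elt)` to the
cover. The family can therefore be evaluated at this lift while the ambiguity in `g` remains visible
in the second summand. -/
lemma π_mk_lift (hX : IsFiberAdditive X) (d : LimIdx X) {a : 𝒜} (g : ofModel d.source ⟶ a) :
    (cover.π X).app _ (cover.mk d.elt (biprod.lift g d.hom)) =
      X.map (biprod.inl : a ⟶ a ⊞ d.target) (X.map g d.elt) := by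
  rw [cover.π_mk]
  apply hX.ext
  · simp only [← type_map_comp_apply, biprod.lift_fst, biprod.inl_fst, Category.comp_id,
      Category.assoc]
  · simp only [← type_map_comp_apply, biprod.lift_snd, biprod.inl_snd, comp_zero, Category.assoc,
      d.map_hom]

open scoped Classical in
/-- The families of coefficients of which the limits are the coefficients of the mean. -/
def meanTerm (hX : IsFiberAdditive X) {a : 𝒜} {v : X.obj a} (θ : Family (cover.π X) (QRep V) v)
    (β : B.obj.obj a) (d : LimIdx X) : V :=
  if h : ∃ g : ofModel d.source ⟶ a, X.map g d.elt = v then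
    coeff V (B.obj.map (biprod.inl : a ⟶ a ⊞ d.target) β)
      (θ.1 ⟨a ⊞ d.target, biprod.inl, cover.mk d.elt (biprod.lift h.choose d.hom),
        (π_mk_lift hX d _).trans (congrArg _ h.choose_spec)⟩)
  else 0

lemma meanTerm_add (hX : IsFiberAdditive X) {a : 𝒜} {v : X.obj a}
    (θ θ' : Family (cover.π X) (QRep V) v) (β : B.obj.obj a) :
    meanTerm hX (θ + θ') β = meanTerm hX θ β + meanTerm hX θ' β := by
  funext d
  rw [Pi.add_apply, meanTerm, meanTerm, meanTerm]
  split_ifs with h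
  · exact map_add _ _ _
  · exact (add_zero _).symm

lemma meanTerm_smul (hX : IsFiberAdditive X) {a : 𝒜} {v : X.obj a} (r : k)
    (θ : Family (cover.π X) (QRep V) v) (β : B.obj.obj a) :
    meanTerm hX (r • θ) β = r • meanTerm hX θ β := by
  funext d
  rw [Pi.smul_apply, meanTerm, meanTerm]
  split_ifs with h
  · exact map_smul (coeff V _) _ _
  · exact (smul_zero _).symm

lemma meanTerm_aut (hX : IsFiberAdditive X) {a : 𝒜} {v : X.obj a}
    (θ : Family (cover.π X) (QRep V) v) (g : Aut B) (β : B.obj.obj a) :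
    meanTerm hX θ (g • β) = fun d => V.ρ g (meanTerm hX θ β d) := by
  funext d
  rw [meanTerm, meanTerm]
  split_ifs with h
  · rw [map_aut_smul, coeff_smul]
  · exact (map_zero _).symm

lemma meanTerm_const (hX : IsFiberAdditive X) [∀ a, Finite (B.obj.obj a)] {a : 𝒜} (v : X.obj a)
    (z : (QRep V).obj a) {β : B.obj.obj a} (hβ : IsGenerating β) :
    meanTerm hX (Family.const v z) β =ᶠ[limFilter hX v] fun _ => coeff V β z := by
  classical
  -- The equality holds at every index admitting a morphism to `v`, so no relation has to be
  -- imposed: `r₀ = 0`.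
  refine ⟨a, v, fun _ => rfl, fun s v₁ g hg => ⟨ofModel s, 0, rfl, fun c r hr _ => ?_⟩⟩
  have := Fintype.ofFinite (B.obj.obj a)
  change meanTerm _ _ _ _ = _
  rw [meanTerm, dif_pos ⟨g, hg⟩]
  have hinl (y : B.obj.obj a) :
      B.obj.map (biprod.fst : a ⊞ c ⟶ a) (B.obj.map biprod.inl y) = y := by
    rw [← map_comp_apply', biprod.inl_fst, map_id_apply']
  refine (coeff_map (V := V) (biprod.inl : a ⟶ a ⊞ c) (β := B.obj.map biprod.inl β)
    (IsGenerating.of_map biprod.fst (by rwa [hinl])) z).trans ?_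
  rw [Finset.sum_eq_single β]
  · intro β' hβ' hne
    rw [Finset.mem_filter_univ] at hβ'
    exact absurd (by rw [← hinl β', hβ', hinl]) hne
  · intro h
    exact absurd (by rw [Finset.mem_filter_univ]) h

-- Naturality of the mean. The lifts chosen over `a` and over `b` need not correspond under `f`, but
-- their discrepancy sends `v₁` to zero, so it factors through every sufficiently universal `r`. A
-- shear of the biproduct then takes one lift to the other.
open scoped Classical in
lemma meanTerm_restrict (hX : IsFiberAdditive X) {a b : 𝒜} [Fintype (B.obj.obj a)]
    [∀ a, Finite (B.obj.obj a)] (f : a ⟶ b)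
    (v : X.obj a) (θ : Family (cover.π X) (QRep V) v) {β : B.obj.obj b} (hβ : IsGenerating β) :
    meanTerm hX (Family.restrict f θ) β =ᶠ[limFilter hX v]
      ∑ α with B.obj.map f α = β, meanTerm hX θ α := by
  refine ⟨a, v, fun _ => rfl, fun s v₁ g hg => ?_⟩
  have h₁ : ∃ g : ofModel s ⟶ a, X.map g v₁ = v := ⟨g, hg⟩
  have h₂ : ∃ g : ofModel s ⟶ b, X.map g v₁ = X.map f v :=
    ⟨g ≫ f, by rw [type_map_comp_apply, hg]⟩
  -- The relation to factor through `r` is the difference between the morphism chosen over `b` and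
  -- the one induced by the choice over `a`.
  refine ⟨b, h₂.choose - h₁.choose ≫ f, hX.map_sub _ _ _ ?_, fun c r hr hh => ?_⟩
  · rw [h₂.choose_spec, type_map_comp_apply, h₁.choose_spec]
  · obtain ⟨q, hq⟩ := hh
    change meanTerm _ _ _ _ = _
    rw [Finset.sum_apply, meanTerm, dif_pos h₂]
    -- The shear `(s, t) ↦ (f s + q t, t)` absorbs the discrepancy `q` and restricts to `f` on the
    -- first summand. Its fibre over the inclusion of `β` consists of the inclusions of the elements
    -- `α` with `f α = β`.
    let u : a ⊞ c ⟶ b ⊞ c := biprod.lift (biprod.desc f q) biprod.snd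
    have hu : biprod.inl ≫ u = f ≫ biprod.inl := by
      apply biprod.hom_ext <;> simp [u]
    have hu' : biprod.lift h₁.choose r ≫ u = biprod.lift h₂.choose r := by
      apply biprod.hom_ext <;> simp [u, biprod.lift_desc, hq]
    have hi := (π_mk_lift hX ⟨s, v₁, c, r, hr⟩ h₁.choose).trans
      (congrArg _ h₁.choose_spec)
    have hj := ((π_mk_lift hX ⟨s, v₁, c, r, hr⟩ h₂.choose).trans
      (congrArg _ h₂.choose_spec)).trans (type_map_comp_apply X _ _ _).symm
    let i : LiftIdx (cover.π X) v :=
      ⟨a ⊞ c, biprod.inl, cover.mk v₁ (biprod.lift h₁.choose r), hi⟩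
    have h := (Family.congr θ (b ⊞ c) hu.symm
      ((congrArg (cover.mk v₁) hu'.symm).trans (cover.map_mk v₁ _ _).symm) hj
      (i.push u).π_lift).trans (θ.2 i _ u)
    have := Fintype.ofFinite (B.obj.obj (a ⊞ c))
    have hinl {e : 𝒜} (y : B.obj.obj e) :
        B.obj.map (biprod.fst : e ⊞ c ⟶ e) (B.obj.map biprod.inl y) = y := by
      rw [← map_comp_apply', biprod.inl_fst, map_id_apply']
    refine (congrArg (coeff V _) h).trans ((coeff_map (V := V) u
      (IsGenerating.of_map biprod.fst (by rwa [hinl])) (θ.1 i)).trans ?_)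
    have hu'' (y : B.obj.obj a) : B.obj.map u (B.obj.map biprod.inl y) =
        B.obj.map biprod.inl (B.obj.map f y) := by
      rw [← map_comp_apply', hu, map_comp_apply']
    have hy (y : B.obj.obj (a ⊞ c)) (hy : B.obj.map u y = B.obj.map biprod.inl β) :
        B.obj.map biprod.inl (B.obj.map biprod.fst y) = y := by
      have hsnd : B.obj.map biprod.snd y = 0 := by
        have h := congrArg (fun y => B.obj.map biprod.snd y) hy
        dsimp only at h
        rwa [← map_comp_apply', ← map_comp_apply', biprod.lift_snd, biprod.inl_snd,
          map_zero_apply'] at h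
      conv_rhs => rw [← map_id_apply' B y, ← biprod.total, map_add_apply', map_comp_apply',
        map_comp_apply', hsnd, map_zero, add_zero]
    refine Finset.sum_nbij' (fun y => B.obj.map biprod.fst y) (fun y => B.obj.map biprod.inl y)
      (fun y h => ?_) (fun y h => ?_) (fun y h => ?_) (fun y _ => hinl y) fun y h => ?_
    all_goals rw [Finset.mem_filter_univ] at h
    · rw [Finset.mem_filter_univ, ← hinl (B.obj.map f _), ← hu'', hy y h, h, hinl]
    · rw [Finset.mem_filter_univ, hu'', h]
    · exact hy y h
    · rw [meanTerm, dif_pos h₁, hy y h]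

/-- The mean on `Q_{B, V}` given by a system of generalised limits with values in `V`. -/
lemma nonempty_mean (hX : IsFiberAdditive X) [∀ a, Finite (B.obj.obj a)]
    (hV : ∀ (l : Filter (LimIdx X)) [l.NeBot], Nonempty (GenLim V l)) :
    Nonempty (Mean (cover.π X) (QRep V)) := by
  classical
  have _ (a : 𝒜) := Fintype.ofFinite (B.obj.obj a)
  let L {a : 𝒜} (v : X.obj a) : GenLim V (limFilter hX v) := (hV (limFilter hX v)).some
  have hL {a b : 𝒜} (f : a ⟶ b) (v : X.obj a) : (L (X.map f v)).lim = (L v).lim := by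
    have (l l' : Filter (LimIdx X)) [l.NeBot] [l'.NeBot] (e : l = l') :
        (hV l).some.lim = (hV l').some.lim := by subst e; rfl
    exact this _ _ (limFilter_map hX f v)
  -- The mean is defined by its coefficients; equivariance of the limit makes them an admissible
  -- family.
  choose val hval using fun (a : 𝒜) (v : X.obj a) (θ : Family (cover.π X) (QRep V) v) =>
    QObj.exists_coeff_eq (V := V) (fun β => (L v).lim (meanTerm hX θ β)) fun g β _ => by
      rw [meanTerm_aut, (L v).lim_ρ]
  refine ⟨⟨fun {a} v =>
    { toFun := val a v
      map_add' θ θ' := QObj.ext_coeff fun β hβ => ?_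
      map_smul' r θ := QObj.ext_coeff fun β hβ => ?_ }, fun {a b} f v θ => ?_, fun {a} v z => ?_⟩⟩
  · rw [map_add, hval _ _ _ _ hβ, hval _ _ _ _ hβ, hval _ _ _ _ hβ, meanTerm_add, map_add]
  · rw [RingHom.id_apply, map_smul, hval _ _ _ _ hβ, hval _ _ _ _ hβ, meanTerm_smul, map_smul]
  · refine QObj.ext_coeff fun β hβ => (coeff_map (V := V) f hβ (val a v θ)).trans ?_
    refine Eq.trans ?_ (hval _ _ _ _ hβ).symm
    rw [hL, (L v).lim_congr (meanTerm_restrict hX f v θ hβ), map_sum]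
    refine Finset.sum_congr rfl fun α hα => hval _ _ _ _ ?_
    rw [Finset.mem_filter_univ] at hα
    exact IsGenerating.of_map f (hα ▸ hβ)
  · refine QObj.ext_coeff fun β hβ => (hval _ _ _ _ hβ).trans ?_
    rw [(L v).lim_congr (meanTerm_const hX v z hβ), (L v).lim_const]

/-- The functors `Q_{B, J}` with `J` injective have no higher extensions by linearisations of
fibrewise additive functors. -/
theorem subsingleton_ext_lin_QRep [HasExt.{t} (FunRep k 𝒜)] [∀ a, Finite (B.obj.obj a)]
    [Small.{w} k[Aut B]] (J : ModuleCat.{w} k[Aut B]) [Injective J] (n : ℕ)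
    (hX : IsFiberAdditive X) :
    Subsingleton (Abelian.Ext (lin k X) ((QFunctor k B).obj J) (n + 1)) :=
  subsingleton_ext_lin (QRep (Rep.ofModuleMonoidAlgebra.obj J)) (fun _ hX => nonempty_mean hX
    fun l _ => nonempty_genLim J l) n X hX

end

end

/-! ### Relations on coefficients; exactness and full faithfulness of `Q_{A,-}` -/

section

open scoped MonoidAlgebra

variable {𝒜 : Type u} [Category.{v} 𝒜] [Preadditive 𝒜]

/-- The hypothesis on relations defines a morphism from the subobject generated by `y` to `B`, onto
since `β` generates. As `A` is not longer than `B`, there is no room for a proper subobject or for a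
kernel. -/
lemma exists_iso_of_relations {A B : AddRep.{w} 𝒜} (hB : IsFiniteObject B)
    (hl : objLength A ≤ objLength B) {a : 𝒜} {y : A.obj.obj a} {β : B.obj.obj a}
    (hβ : IsGenerating β) (h : ∀ ⦃c : 𝒜⦄ (r : a ⟶ c), A.obj.map r y = 0 → B.obj.map r β = 0) :
    IsGenerating y ∧ ∃ φ : A ≅ B, φ.hom.hom.app a y = β := by
  have hsurj {D : AddRep.{w} 𝒜} {η : D.obj.obj a} (φ : D ⟶ B) (hφ : φ.hom.app a η = β) (b : 𝒜) :
      Function.Surjective (φ.hom.app b) := fun z => by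
    obtain ⟨f, hf⟩ := hβ z
    exact ⟨D.obj.map f η, by rw [naturality_apply', hφ, hf]⟩
  let η : (SubRep.span y).toRep.obj.obj a := ⟨y, SubRep.self_mem_span y⟩
  have hη : IsGenerating η := fun b z => by
    obtain ⟨f, hf⟩ := (SubRep.mem_span y z.1).1 z.2
    exact ⟨f, Subtype.ext hf⟩
  obtain ⟨φ, hφ⟩ := hη.exists_hom β fun c r hr => h r (congrArg Subtype.val hr)
  obtain ⟨htop, -⟩ := SubRep.isIso_of_surjective_of_objLength_le hB hl _ φ (hsurj φ hφ)
  have hy := (span_eq_top_iff y).1 htop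
  obtain ⟨ψ, hψ⟩ := hy.exists_hom β h
  have h₁ : IsIso (SubRep.ι (⊤ : SubRep A)) := SubRep.isIso_of_bijective _ fun b =>
    ⟨Subtype.val_injective, fun z => ⟨⟨z, trivial⟩, rfl⟩⟩
  have h₂ : IsIso ((⊤ : SubRep A).ι ≫ ψ) :=
    (SubRep.isIso_of_surjective_of_objLength_le hB hl _ ((⊤ : SubRep A).ι ≫ ψ)
      (hsurj (η := (⟨y, trivial⟩ : (⊤ : SubRep A).carrier a)) _ hψ)).2
  have h₃ : IsIso ψ := IsIso.of_isIso_comp_left (⊤ : SubRep A).ι ψ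
  exact ⟨hy, asIso ψ, hψ⟩

variable {k : Type w} [Field k] {A B : AddRep.{w} 𝒜}

/-- The functor `Q_{A, -}` on representations of `Aut A`. -/
def QRepFunctor (k : Type w) [Field k] (A : AddRep.{w} 𝒜) : Rep.{w} k (Aut A) ⥤ FunRep k 𝒜 :=
  Rep.coinvariantsTensor k (Aut A) ⋙ (Functor.whiskeringLeft 𝒜 _ _).obj (QA k A)

lemma QRepFunctor_map_app_qmk {V W : Rep.{w} k (Aut A)} (φ : V ⟶ W) {a : 𝒜} (v : A.obj.obj a)
    (m : V) : (((QRepFunctor k A).map φ).app a).hom (qmk V v m) = qmk W v (φ.hom m) :=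
  QObj.map_left_qmk φ v m

lemma QRep.hom_ext {V : Rep.{w} k (Aut A)} {W : Rep.{w} k (Aut B)} {τ τ' : QRep V ⟶ QRep W} (h : ∀ (a : 𝒜) (v : A.obj.obj a) (m : V),
    (τ.app a).hom (qmk V v m) = (τ'.app a).hom (qmk V v m)) : τ = τ' := by
  refine NatTrans.ext (funext fun a => ModuleCat.hom_ext (LinearMap.ext fun z => ?_))
  induction z using QObj.induction with
  | zero => rw [map_zero, map_zero]
  | add x y hx hy => rw [map_add, map_add, hx, hy]
  | mk v m _ => exact h a v m

/-- Exactness is checked on coefficients. Preimages are used only at orbit representatives, so they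
need no compatibility with the action. -/
lemma QFunctor_map_exact [∀ a, Finite (B.obj.obj a)] (S : ShortComplex (ModuleCat.{w} k[Aut B])) (hS : S.Exact) :
    (S.map (QFunctor k B)).Exact := by
  refine (FunRep.exact_iff _).2 fun a z hz => ?_
  have := Fintype.ofFinite (GenOrbit B a)
  have hS' := (ShortComplex.moduleCat_exact_iff S).1 hS
  have hc (β : B.obj.obj a) : ∃ m : Rep.ofModuleMonoidAlgebra.obj S.X₁,
      (Rep.ofModuleMonoidAlgebra.map S.f).hom m =
        coeff (Rep.ofModuleMonoidAlgebra.obj S.X₂) β z := by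
    refine hS' _ ?_
    refine (coeff_map_left (Rep.ofModuleMonoidAlgebra.map S.g) β z).symm.trans ?_
    exact (congrArg (coeff _ β) hz).trans (map_zero _)
  choose m hm using hc
  refine ⟨∑ o : GenOrbit B a, qmk (Rep.ofModuleMonoidAlgebra.obj S.X₁) (Quotient.out o.1)
    (m (Quotient.out o.1)), ?_⟩
  refine (map_sum _ _ _).trans ?_
  refine Eq.trans ?_ (sum_coeff_qmk (V := Rep.ofModuleMonoidAlgebra.obj S.X₂) z)
  refine Finset.sum_congr rfl fun o _ => ?_
  exact (QRepFunctor_map_app_qmk (Rep.ofModuleMonoidAlgebra.map S.f) _ _).trans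
    (congrArg _ (hm _))

lemma QFunctor_preserves [∀ a, Finite (B.obj.obj a)] : PreservesFiniteLimits (QFunctor k B) ∧
    PreservesFiniteColimits (QFunctor k B) :=
  ((QFunctor k B).exact_tfae.out 1 3).1 QFunctor_map_exact

variable [HasFiniteBiproducts 𝒜]

attribute [local instance] hasBinaryBiproducts_of_finite_biproducts

variable {V : Rep.{w} k (Aut A)}
  {W : Rep.{w} k (Aut B)} [∀ a, Finite (B.obj.obj a)]

/-- Relations on an element of `Q_{B, W}` are relations on the elements of `B` at which it has
nonzero coefficients. -/
lemma map_eq_zero_of_coeff_ne_zero {a c : 𝒜} {z : (QRep W).obj a} {β : B.obj.obj a}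
    (hβ : IsGenerating β) (hz : coeff W β z ≠ 0) (r : a ⟶ c)
    (hr : ((QRep W).map (biprod.lift (𝟙 a) r)).hom z =
      ((QRep W).map (biprod.lift (𝟙 a) 0)).hom z) : B.obj.map r β = 0 := by
  classical
  have := Fintype.ofFinite (B.obj.obj a)
  have hfst (r : a ⟶ c) (y : B.obj.obj a) :
      B.obj.map biprod.fst (B.obj.map (biprod.lift (𝟙 a) r) y) = y := by
    rw [← map_comp_apply', biprod.lift_fst, map_id_apply']
  have hgen : IsGenerating (B.obj.map (biprod.lift (𝟙 a) r) β) :=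
    IsGenerating.of_map biprod.fst (by rwa [hfst])
  -- Compare the coefficients at `(β, r β)` of the images of `z` under `(1, r)` and `(1, 0)`. The
  -- first is the coefficient of `z` at `β`; the second can be nonzero only if `(β, r β)` has the
  -- form `(β', 0)`.
  have h := (coeff_map (V := W) _ hgen z).symm.trans
    ((congrArg (coeff W _) hr).trans (coeff_map (V := W) _ hgen z))
  rw [Finset.sum_eq_single β] at h
  · rw [h] at hz
    obtain ⟨β', hβ', -⟩ := Finset.exists_ne_zero_of_sum_ne_zero hz
    rw [Finset.mem_filter_univ] at hβ'
    have h' := congrArg (fun y => B.obj.map biprod.snd y) hβ'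
    dsimp only at h'
    rw [← map_comp_apply', ← map_comp_apply', biprod.lift_snd, biprod.lift_snd,
      map_zero_apply'] at h'
    exact h'.symm
  · intro β' hβ' hne
    rw [Finset.mem_filter_univ] at hβ'
    exact absurd (by rw [← hfst r β', hβ', hfst]) hne
  · intro h
    exact absurd (by rw [Finset.mem_filter_univ]) h

lemma map_eq_zero_of_coeff_lin_ne_zero {X : 𝒜 ⥤ Type w} (hX : IsFiberAdditive X)
    (φ : lin k X ⟶ QRep W) {a c : 𝒜} {y : X.obj a} {β : B.obj.obj a} (hβ : IsGenerating β)
    (hz : coeff W β ((φ.app a).hom (pt k y)) ≠ 0) (r : a ⟶ c) (hr : X.map r y = X.map 0 y) :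
    B.obj.map r β = 0 := by
  refine map_eq_zero_of_coeff_ne_zero hβ hz r ?_
  rw [← app_pt_naturality, ← app_pt_naturality]
  congr 2
  apply hX.ext
  · simp only [← type_map_comp_apply, biprod.lift_fst]
  · simp only [← type_map_comp_apply, biprod.lift_snd, hr]

lemma map_eq_zero_of_coeff_hom_ne_zero (τ : QRep V ⟶ QRep W) {a c : 𝒜} {v : A.obj.obj a} {m : V}
    {β : B.obj.obj a} (hβ : IsGenerating β)
    (hz : coeff W β ((τ.app a).hom (qmk V v m)) ≠ 0) (r : a ⟶ c) (hr : A.obj.map r v = 0) :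
    B.obj.map r β = 0 := by
  refine map_eq_zero_of_coeff_ne_zero hβ hz r ?_
  rw [← FunRep.naturality_apply, ← FunRep.naturality_apply]
  refine congrArg (τ.app _).hom ((QObj.map_qmk _ v m).trans
    (Eq.trans ?_ (QObj.map_qmk _ v m).symm))
  congr 1
  have h : biprod.lift (𝟙 a) r = biprod.lift (𝟙 a) 0 + r ≫ biprod.inr := by
    apply biprod.hom_ext <;> simp
  rw [h, map_add_apply', map_comp_apply', hr, map_zero, add_zero]

lemma QRep.hom_eq_zero (hB : IsFiniteObject B) (hl : objLength A ≤ objLength B)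
    (hAB : IsEmpty (A ≅ B)) (τ : QRep V ⟶ QRep W) : τ = 0 := by
  refine QRep.hom_ext fun a v m => QObj.ext_coeff fun β hβ => ?_
  change _ = coeff W β 0
  rw [map_zero]
  by_contra hz
  obtain ⟨-, φ, -⟩ := exists_iso_of_relations hB hl (y := v) hβ fun c r hr =>
    map_eq_zero_of_coeff_hom_ne_zero τ hβ hz r hr
  exact hAB.false φ

lemma QRepFunctor_faithful [IsNoetherianObject A] : (QRepFunctor k A).Faithful where
  map_injective {V W φ ψ} h := by
    obtain ⟨x, ξ, hξ⟩ := exists_isGenerating A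
    ext m
    have h' := congr(coeff W ξ ((ModuleCat.Hom.hom (NatTrans.app $h x)) (qmk V ξ m)))
    rwa [QRepFunctor_map_app_qmk, QRepFunctor_map_app_qmk, coeff_qmk_self hξ,
      coeff_qmk_self hξ] at h'

/-- Every morphism between the functors `Q_{B, V}` and `Q_{B, W}` is induced by a morphism of
representations. -/
lemma QRep.exists_hom (hB : IsFiniteObject B) {V W : Rep.{w} k (Aut B)} (τ : QRep V ⟶ QRep W) :
    ∃ φ : V ⟶ W, ∀ {a : 𝒜} (v : B.obj.obj a) (m : V),
      (τ.app a).hom (qmk V v m) = qmk W v (φ.hom m) := by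
  classical
  have := hB.isNoetherian
  obtain ⟨x, ξ, hξ⟩ := exists_isGenerating B
  have := Fintype.ofFinite (B.obj.obj x)
  let ψ : V →ₗ[k] W := coeff W ξ ∘ₗ (τ.app x).hom ∘ₗ qmk V ξ
  -- The image of the class at `ξ` is supported on the orbit of `ξ`, so a single coefficient
  -- determines it; as `ξ` generates, it then determines `τ`.
  have hτ (m : V) (β : B.obj.obj x) (hβ : IsGenerating β)
      (hz : coeff W β ((τ.app x).hom (qmk V ξ m)) ≠ 0) : ∃ g : Aut B, g • ξ = β :=
    (exists_iso_of_relations hB le_rfl (y := ξ) hβ fun c r hr =>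
      map_eq_zero_of_coeff_hom_ne_zero τ hβ hz r hr).2
  have hψ (m : V) : (τ.app x).hom (qmk V ξ m) = qmk W ξ (ψ m) := by
    refine QObj.ext_coeff fun β hβ => ?_
    rw [coeff_qmk]
    by_cases h : ∃ g : Aut B, g • ξ = β
    · obtain ⟨g, rfl⟩ := h
      rw [autCoeff_of_smul_eq hβ g rfl, coeff_smul]
      rfl
    · rw [autCoeff_of_forall_ne (not_exists.1 h), LinearMap.zero_apply]
      by_contra hz
      exact h (hτ m β hβ hz)
  have hψ' {a : 𝒜} (v : B.obj.obj a) (m : V) :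
      (τ.app a).hom (qmk V v m) = qmk W v (ψ m) := by
    obtain ⟨f, rfl⟩ := hξ v
    refine (congrArg (τ.app a).hom (QObj.map_qmk f ξ m).symm).trans ?_
    refine (FunRep.naturality_apply τ f _).trans ?_
    rw [hψ]
    exact QObj.map_qmk f ξ (ψ m)
  have hψ'' (g : Aut B) (m : V) : ψ (V.ρ g m) = W.ρ g (ψ m) := by
    have h := hψ' (g • ξ) (V.ρ g m)
    rw [qmk_aut, hψ', ← qmk_aut g] at h
    have h' := congrArg (coeff W (g • ξ)) h
    rwa [coeff_qmk_self (hξ.aut_smul g), coeff_qmk_self (hξ.aut_smul g), eq_comm] at h'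
  exact ⟨Rep.ofHom { toLinearMap := ψ, isIntertwining' := fun g => LinearMap.ext (hψ'' g) }, hψ'⟩

lemma QRepFunctor_full (hB : IsFiniteObject B) : (QRepFunctor k B).Full where
  map_surjective τ := by
    obtain ⟨φ, hφ⟩ := QRep.exists_hom hB τ
    exact ⟨φ, QRep.hom_ext (τ' := τ) fun a v m => (QRepFunctor_map_app_qmk φ v m).trans (hφ v m).symm⟩

lemma QFunctor_faithful [IsNoetherianObject A] : (QFunctor k A).Faithful :=
  have := QRepFunctor_faithful (k := k) (A := A)
  inferInstanceAs (Rep.ofModuleMonoidAlgebra ⋙ QRepFunctor k A).Faithful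

lemma QFunctor_full (hB : IsFiniteObject B) : (QFunctor k B).Full :=
  have := QRepFunctor_full (k := k) hB
  inferInstanceAs (Rep.ofModuleMonoidAlgebra ⋙ QRepFunctor k B).Full

end

section

open scoped MonoidAlgebra

/-! ### Resolution of `Q_{A,L}` for free `L` -/

section

universe t

variable {𝒜 : Type u} [Category.{v} 𝒜] [Preadditive 𝒜] {k : Type w} [Field k]
  {A : AddRep.{w} 𝒜}

/-- A family of set-valued subfunctors of `A`. -/
structure SubFam (A : AddRep.{w} 𝒜) (K : Type w) where
  /-- The values of the subfunctors. -/
  carrier (i : K) (a : 𝒜) : Set (A.obj.obj a)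
  map_mem (i : K) {a b : 𝒜} (f : a ⟶ b) {x : A.obj.obj a} :
    x ∈ carrier i a → A.obj.map f x ∈ carrier i b

namespace SubFam

variable {K : Type w} (S : SubFam A K)

/-- The disjoint union of a family of subfunctors, as a functor to sets. -/
def sigma : 𝒜 ⥤ Type w where
  obj a := {t : A.obj.obj a × K // t.1 ∈ S.carrier t.2 a}
  map f := ↾fun t => ⟨(A.obj.map f t.1.1, t.1.2), S.map_mem t.1.2 f t.2⟩
  map_id a := ConcreteCategory.hom_ext _ _
    fun t : {t : A.obj.obj a × K // t.1 ∈ S.carrier t.2 a} =>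
      Subtype.ext (a1 := ⟨(A.obj.map (𝟙 a) t.1.1, t.1.2), S.map_mem _ _ t.2⟩) (a2 := t)
        (Prod.ext (map_id_apply' A t.1.1) rfl)
  map_comp {a _ _} f g := ConcreteCategory.hom_ext _ _
    fun t : {t : A.obj.obj a × K // t.1 ∈ S.carrier t.2 a} =>
      Subtype.ext (a1 := ⟨(A.obj.map (f ≫ g) t.1.1, t.1.2), S.map_mem _ _ t.2⟩)
        (a2 := ⟨(A.obj.map g (A.obj.map f t.1.1), t.1.2), S.map_mem _ _ (S.map_mem _ _ t.2)⟩)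
        (Prod.ext (map_comp_apply' A f g t.1.1) rfl)

variable {S} {a b c : 𝒜}

/-- The underlying element of `A`. -/
def elt (t : S.sigma.obj a) : A.obj.obj a := t.1.1

/-- The index of the subfunctor. -/
def idx (t : S.sigma.obj a) : K := t.1.2

lemma elt_mem (t : S.sigma.obj a) : elt t ∈ S.carrier (idx t) a := t.2

/-- The element of the disjoint union with given components. -/
def of (i : K) (v : A.obj.obj a) (hv : v ∈ S.carrier i a) : S.sigma.obj a := ⟨(v, i), hv⟩

lemma ext {t t' : S.sigma.obj a} (h : elt t = elt t') (h' : idx t = idx t') : t = t' :=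
  Subtype.ext (Prod.ext h h')

end SubFam

/-- The constant family with value `A`. -/
def fullFam (A : AddRep.{w} 𝒜) (I : Type w) : SubFam A I where
  carrier _ _ := Set.univ
  map_mem _ _ _ _ _ _ := trivial

/-- The constant family whose value is the set of elements which are not generating. -/
def nongenFam (A : AddRep.{w} 𝒜) (I : Type w) : SubFam A I where
  carrier _ _ := {v | ¬ IsGenerating v}
  map_mem _ _ _ f _ h h' := h (IsGenerating.of_map f h')

/-- The inclusion of the elements which are not generating. -/
def nongenι (A : AddRep.{w} 𝒜) (I : Type w) : (nongenFam A I).sigma ⟶ (fullFam A I).sigma where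
  app _ := ↾fun t => SubFam.of (SubFam.idx t) (SubFam.elt t) trivial
  naturality _ _ _ := rfl

/-- The elements of `A` sent to `H` by all morphisms to `x`. -/
def subOf {x : 𝒜} (H : AddSubgroup (A.obj.obj x)) : SubRep A where
  carrier a :=
    { carrier := {v | ∀ f : a ⟶ x, A.obj.map f v ∈ H}
      zero_mem' f := by rw [map_zero]; exact H.zero_mem
      add_mem' h h' f := by rw [map_add]; exact H.add_mem (h f) (h' f)
      neg_mem' h f := by rw [map_neg]; exact H.neg_mem (h f) }
  map_mem f v hv g := by
    rw [← map_comp_apply']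
    exact hv (f ≫ g)

/-- The additive subfunctors whose union is the set of elements which are not generating. -/
def coverFam {x : 𝒜} (ξ : A.obj.obj x) (I : Type w) :
    SubFam A (I × {H : AddSubgroup (A.obj.obj x) // ξ ∉ H}) where
  carrier i a := (subOf i.2.1).carrier a
  map_mem i _ _ f _ h := (subOf i.2.1).map_mem f h

/-- The covering of the set of elements which are not generating by additive subfunctors. -/
def nongenπ {x : 𝒜} (ξ : A.obj.obj x) (I : Type w) :
    (coverFam ξ I).sigma ⟶ (nongenFam A I).sigma where
  app _ := ↾fun t => SubFam.of (SubFam.idx t).1 (SubFam.elt t) fun h => by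
    obtain ⟨f, hf⟩ := h ξ
    exact (SubFam.idx t).2.2 ((congrArg (· ∈ (SubFam.idx t).2.1) hf).mp (SubFam.elt_mem t f))
  naturality _ _ _ := rfl

/-- An element generates exactly when its span contains `ξ`; for a non-generating `v` the subgroup
of `A(x)` to use is the value at `x` of its span. -/
lemma nongenπ_surjective {x : 𝒜} {ξ : A.obj.obj x} (hξ : IsGenerating ξ) (I : Type w) (a : 𝒜) :
    Function.Surjective ((nongenπ ξ I).app a) := fun t => by
  let v := SubFam.elt t
  refine ⟨SubFam.of (SubFam.idx t, ⟨(SubRep.span v).carrier x, fun h => SubFam.elt_mem t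
    fun b y => ?_⟩) v fun f => ⟨f, rfl⟩, rfl⟩
  obtain ⟨f, hf⟩ := (SubRep.mem_span v ξ).1 h
  obtain ⟨g, rfl⟩ := hξ y
  exact ⟨f ≫ g, by rw [map_comp_apply', hf]⟩

/-! ### The resolution of `Q_{A, L}` with `L` free -/

/-- The morphism from the linearisation of copies of `A` to `Q_{A, L}` given by a family of elements
of `L`. -/
def freeDesc {L : Rep.{w} k (Aut A)} {I : Type w} (e : I → L) :
    lin k (fullFam A I).sigma ⟶ QRep L :=
  linDesc (fun _ t => qmk L (SubFam.elt t) (e (SubFam.idx t))) fun f t =>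
    (QObj.map_qmk f (SubFam.elt t) (e (SubFam.idx t))).symm

lemma freeDesc_pt {L : Rep.{w} k (Aut A)} {I : Type w} (e : I → L) {a : 𝒜}
    (t : (fullFam A I).sigma.obj a) : ((freeDesc e).app a).hom (pt k t) =
      qmk L (SubFam.elt t) (e (SubFam.idx t)) :=
  linMapDesc_pt _ _

/-- A basis of a representation as a module over the group algebra. -/
structure FreeBasis (L : Rep.{w} k (Aut A)) (I : Type w) where
  /-- The elements of the basis. -/
  e : I → L
  /-- The coordinates at the identity element. -/
  coord (i : I) : L →ₗ[k] k
  coord_self (i : I) : coord i (e i) = 1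
  coord_of_ne {i j : I} {g : Aut A} (h : ¬ (i = j ∧ g = 1)) : coord i (L.ρ g (e j)) = 0
  induction {P : L → Prop} (zero : P 0) (add : ∀ x y, P x → P y → P (x + y))
    (mk : ∀ (r : k) (g : Aut A) (i : I), P (r • L.ρ g (e i))) (x : L) : P x

variable {L : Rep.{w} k (Aut A)} {I : Type w} (b : FreeBasis L I)

lemma FreeBasis.epi_freeDesc : Epi (freeDesc b.e) := by
  refine (FunRep.epi_iff _).2 fun a z => ?_
  change z ∈ LinearMap.range ((freeDesc b.e).app a).hom
  induction z using QObj.induction with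
  | zero => exact zero_mem _
  | add x y hx hy => exact add_mem hx hy
  | mk v m hv =>
    induction m using b.induction with
    | zero => rw [map_zero]; exact zero_mem _
    | add x y hx hy => rw [map_add]; exact add_mem hx hy
    | mk r g i =>
      rw [map_smul]
      refine Submodule.smul_mem _ r ⟨pt k (SubFam.of i (g⁻¹ • v) trivial), ?_⟩
      rw [freeDesc_pt]
      exact (qmk_aut g (g⁻¹ • v) (b.e i)).symm.trans (by rw [smul_inv_smul])

/-- Coordinates at generating elements can be read off from the image in `Q_{A,L}`, so the kernel of
`freeDesc` is supported on the non-generating ones. -/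
lemma FreeBasis.coord_coeff_freeDesc {a : 𝒜} (z : (lin k (fullFam A I).sigma).obj a) {β : A.obj.obj a}
    (hβ : IsGenerating β) (i : I) :
    b.coord i (coeff L β (((freeDesc b.e).app a).hom z)) =
      (show (fullFam A I).sigma.obj a →₀ k from z) (SubFam.of i β trivial) := by
  classical
  induction z using lin_induction with
  | zero => simp only [map_zero]; rfl
  | add x y hx hy => simp only [map_add, hx, hy]; rfl
  | smul r x hx => simp only [map_smul, hx]; rfl
  | pt t =>
    rw [freeDesc_pt, coeff_qmk]
    change _ = (Finsupp.single t (1 : k)) (SubFam.of i β trivial)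
    rw [Finsupp.single_apply]
    by_cases h : ∃ g : Aut A, g • SubFam.elt t = β
    · obtain ⟨g, hg⟩ := h
      rw [autCoeff_of_smul_eq hβ g hg]
      by_cases h' : i = SubFam.idx t ∧ g = 1
      · obtain ⟨rfl, rfl⟩ := h'
        have ht : t = SubFam.of (S := fullFam A I) (SubFam.idx t) β trivial :=
          SubFam.ext ((one_smul (Aut A) (SubFam.elt t)).symm.trans hg) rfl
        rw [map_one, if_pos ht]
        exact b.coord_self _
      · rw [b.coord_of_ne h', if_neg]
        rintro rfl
        exact h' ⟨rfl, IsGenerating.aut_eq (v := β) hβ (hg.trans (one_smul _ β).symm)⟩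
    · rw [autCoeff_of_forall_ne (not_exists.1 h), if_neg]
      · exact map_zero _
      · rintro rfl
        exact h ⟨1, one_smul _ _⟩

lemma lin_nongenι_freeDesc (e : I → L) :
    Functor.whiskerRight (nongenι A I) (ModuleCat.free k) ≫ freeDesc e = 0 := by
  refine lin_hom_ext fun a t => ?_
  rw [FunRep.comp_apply]
  refine (congrArg _ (ModuleCat.free_map_apply _ _)).trans ?_
  refine (freeDesc_pt e _).trans ?_
  exact qmk_eq_zero (SubFam.elt_mem t) _

lemma nongenι_injective (a : 𝒜) : Function.Injective ((nongenι A I).app a) := fun _ _ h =>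
  have h₁ := congrArg SubFam.elt h
  have h₂ := congrArg SubFam.idx h
  SubFam.ext h₁ h₂

lemma lin_nongenι_injective (k : Type w) [Field k] (a : 𝒜) : Function.Injective
    ((Functor.whiskerRight (nongenι A I) (ModuleCat.free k)).app a).hom :=
  Finsupp.mapDomain_injective (nongenι_injective a)

lemma exists_lin_nongenι_eq {a : 𝒜} (z : (lin k (fullFam A I).sigma).obj a)
    (hz : ∀ (i : I) (β : A.obj.obj a), IsGenerating β →
      (show (fullFam A I).sigma.obj a →₀ k from z) (SubFam.of i β trivial) = 0) :
    ∃ y, ((Functor.whiskerRight (nongenι A I) (ModuleCat.free k)).app a).hom y = z := by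
  let z' : (fullFam A I).sigma.obj a →₀ k := z
  refine ⟨Finsupp.comapDomain ((nongenι A I).app a) z' (nongenι_injective a).injOn,
    Finsupp.mapDomain_comapDomain _ (nongenι_injective a) z' fun t ht => ?_⟩
  by_cases h : IsGenerating (SubFam.elt t)
  · exact absurd (hz (SubFam.idx t) _ h) (Finsupp.mem_support_iff.1 ht)
  · exact ⟨SubFam.of (SubFam.idx t) (SubFam.elt t) h, rfl⟩

variable [HasFiniteBiproducts 𝒜]

attribute [local instance] hasBinaryBiproducts_of_finite_biproducts

lemma ext_biprod {a c : 𝒜} {v v' : A.obj.obj (a ⊞ c)}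
    (h : A.obj.map biprod.fst v = A.obj.map biprod.fst v')
    (h' : A.obj.map biprod.snd v = A.obj.map biprod.snd v') : v = v' := by
  rw [← map_id_apply' A v, ← map_id_apply' A v', ← biprod.total, map_add_apply', map_add_apply',
    map_comp_apply', map_comp_apply', map_comp_apply', map_comp_apply', h, h']

lemma exists_biprod_lift {a c : 𝒜} (v : A.obj.obj a) (v' : A.obj.obj c) :
    ∃ t : A.obj.obj (a ⊞ c), A.obj.map biprod.fst t = v ∧ A.obj.map biprod.snd t = v' :=
  ⟨A.obj.map biprod.inl v + A.obj.map biprod.inr v', by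
    rw [map_add, ← map_comp_apply', ← map_comp_apply', biprod.inl_fst, biprod.inr_fst,
      map_id_apply', map_zero_apply', add_zero], by
    rw [map_add, ← map_comp_apply', ← map_comp_apply', biprod.inl_snd, biprod.inr_snd,
      map_id_apply', map_zero_apply', zero_add]⟩

lemma SubFam.sigma_ext {K : Type w} {S : SubFam A K} {a c : 𝒜} {t t' : S.sigma.obj (a ⊞ c)}
    (h : S.sigma.map biprod.fst t = S.sigma.map biprod.fst t')
    (h' : S.sigma.map biprod.snd t = S.sigma.map biprod.snd t') : t = t' :=
  have hi := congrArg SubFam.idx h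
  SubFam.ext (ext_biprod (congrArg SubFam.elt h) (congrArg SubFam.elt h')) hi

lemma SubFam.sigma_isFiberAdditive {K : Type w} (S : SubFam A K)
    (hS : ∀ (i : K) {a c : 𝒜} (t : A.obj.obj (a ⊞ c)), A.obj.map biprod.fst t ∈ S.carrier i a →
      A.obj.map biprod.snd t ∈ S.carrier i c → t ∈ S.carrier i (a ⊞ c)) :
    IsFiberAdditive S.sigma where
  exists_lift {a c} t t' h := by
    have hi : idx t = idx t' := congrArg SubFam.idx (h a)
    obtain ⟨v, hv, hv'⟩ := exists_biprod_lift (elt t) (elt t')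
    exact ⟨SubFam.of (idx t) v (hS _ v (hv ▸ elt_mem t) (hv' ▸ hi ▸ elt_mem t')),
      SubFam.ext hv rfl, SubFam.ext hv' hi⟩
  ext := SubFam.sigma_ext

lemma fullFam_isFiberAdditive (I : Type w) : IsFiberAdditive (fullFam A I).sigma :=
  SubFam.sigma_isFiberAdditive _ fun _ _ _ _ _ _ => trivial

lemma coverFam_isFiberAdditive {x : 𝒜} (ξ : A.obj.obj x) (I : Type w) :
    IsFiberAdditive (coverFam ξ I).sigma :=
  SubFam.sigma_isFiberAdditive _ fun i a c t h h' => by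
    have ht : t = A.obj.map biprod.inl (A.obj.map biprod.fst t) +
        A.obj.map biprod.inr (A.obj.map biprod.snd t) := by
      conv_lhs => rw [← map_id_apply' A t, ← biprod.total, map_add_apply', map_comp_apply',
        map_comp_apply']
    rw [ht]
    exact add_mem ((subOf i.2.1).map_mem _ h) ((subOf i.2.1).map_mem _ h')

/-- The fibre powers of positive order of a fibrewise additive functor over a functor satisfying the
uniqueness condition are fibrewise additive. -/
lemma IsFiberAdditive.cech_succ {P X : 𝒜 ⥤ Type w} (hP : IsFiberAdditive P)
    (hX : ∀ {a c : 𝒜} {t t' : X.obj (a ⊞ c)}, X.map biprod.fst t = X.map biprod.fst t' →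
      X.map biprod.snd t = X.map biprod.snd t' → t = t')
    (π : P ⟶ X) (p : ℕ) : IsFiberAdditive (GenericRep.cech π (p + 1)) where
  exists_lift {a c} y y' h := by
    choose t ht ht' using fun i => hP.exists_lift (cech.comp y i) (cech.comp y' i)
      fun e => congrArg (fun y => cech.comp y i) (h e)
    refine ⟨⟨(π.app _ (t 0), t), fun i => hX ?_ ?_⟩, cech.ext ?_ ht, cech.ext ?_ ht'⟩
    · rw [← type_naturality_apply, ← type_naturality_apply, ht, ht, cech.π_comp, cech.π_comp]
    · rw [← type_naturality_apply, ← type_naturality_apply, ht', ht', cech.π_comp, cech.π_comp]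
    · exact (type_naturality_apply π _ _).symm.trans ((congrArg _ (ht 0)).trans (cech.π_comp y 0))
    · exact (type_naturality_apply π _ _).symm.trans
        ((congrArg _ (ht' 0)).trans (cech.π_comp y' 0))
  ext {a c} y y' h h' := cech.ext (hX (congrArg cech.base h) (congrArg cech.base h'))
    fun i => hP.ext (congrArg (fun y => cech.comp y i) h) (congrArg (fun y => cech.comp y i) h')


section Resolution

variable {x : 𝒜} (ξ : A.obj.obj x)

lemma coverFam_cech_isFiberAdditive (I : Type w) (p : ℕ) :
    IsFiberAdditive (cech (nongenπ ξ I) (p + 1)) :=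
  (coverFam_isFiberAdditive ξ I).cech_succ SubFam.sigma_ext _ p

/-- All components of a point of a fibre power have the same underlying element of `A`, so its
relations pass to any `β` with nonzero coefficient. That element would then generate `A`, which it
does not. -/
lemma lin_cech_hom_eq_zero {B : AddRep.{w} 𝒜} [∀ a, Finite (B.obj.obj a)] (hB : IsFiniteObject B)
    (hl : objLength A ≤ objLength B) {W : Rep.{w} k (Aut B)} {p : ℕ}
    (φ : lin k (cech (nongenπ ξ I) (p + 1)) ⟶ QRep W) : φ = 0 := by
  refine lin_hom_ext fun a y => QObj.ext_coeff fun β hβ => ?_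
  change _ = coeff W β 0
  rw [map_zero]
  by_contra hz
  refine SubFam.elt_mem (cech.base y) (exists_iso_of_relations hB hl hβ fun c r hr => ?_).1
  refine map_eq_zero_of_coeff_lin_ne_zero (coverFam_cech_isFiberAdditive ξ I p) φ hβ hz r ?_
  have h : A.obj.map r (SubFam.elt (cech.base y)) =
      A.obj.map (0 : a ⟶ c) (SubFam.elt (cech.base y)) := by rw [hr, map_zero_apply']
  refine cech.ext (SubFam.ext h rfl) fun i => SubFam.ext ?_ rfl
  have hi : SubFam.elt (cech.comp y i) = SubFam.elt (cech.base y) :=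
    congrArg SubFam.elt (cech.π_comp y i)
  change A.obj.map r (SubFam.elt (cech.comp y i)) = A.obj.map 0 (SubFam.elt (cech.comp y i))
  rw [hi, h]

/-- The terms of the resolution. -/
def resObj (k : Type w) [Field k] (I : Type w) : ℕ → FunRep k 𝒜
  | 0 => lin k (fullFam A I).sigma
  | p + 1 => lin k (cech (nongenπ ξ I) (p + 1))

/-- The differentials of the resolution. -/
def resD (k : Type w) [Field k] (I : Type w) : ∀ p, resObj ξ k I (p + 1) ⟶ resObj ξ k I p
  | 0 => cechD k (nongenπ ξ I) 0 ≫ (linIso k (cechZeroIso (nongenπ ξ I))).hom ≫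
      Functor.whiskerRight (nongenι A I) (ModuleCat.free k)
  | p + 1 => cechD k (nongenπ ξ I) (p + 1)

open Abelian in
/-- The functors `Q_{A, L}` with `L` free have no higher extensions by the functors `Q_{B, J}`
with `J` injective. -/
theorem FreeBasis.subsingleton_ext (b : FreeBasis L I) [EssentiallySmall.{w} 𝒜] [HasExt.{t} (FunRep k 𝒜)]
    {B : AddRep.{w} 𝒜} [∀ a, Finite (B.obj.obj a)] (hB : IsFiniteObject B)
    (hl : objLength A ≤ objLength B) {ξ : A.obj.obj x} (hξ : IsGenerating ξ)
    [Small.{w} k[Aut B]] (J : ModuleCat.{w} k[Aut B]) [Injective J] (n : ℕ) :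
    Subsingleton (Ext (QRep L) ((QFunctor k B).obj J) (n + 1)) := by
  have hπ := nongenπ_surjective hξ I
  have hS (a : 𝒜) : ∃ σ : (nongenFam A I).sigma.obj a → (coverFam ξ I).sigma.obj a,
      ∀ v, (nongenπ ξ I).app a (σ v) = v := ⟨_, Function.surjInv_eq (hπ a)⟩
  have hd (p : ℕ) : cechD k (nongenπ ξ I) (p + 1) ≫ cechD k (nongenπ ξ I) p = 0 :=
    NatTrans.ext (funext fun a => ModuleCat.hom_ext (LinearMap.ext fun z =>
      cechD_cechD (hπ a) p z))
  have hd' (p : ℕ) : resD ξ k I (p + 1) ≫ resD ξ k I p = 0 := by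
    cases p with
    | zero =>
      change cechD k (nongenπ ξ I) 1 ≫ cechD k (nongenπ ξ I) 0 ≫ _ = 0
      rw [← Category.assoc, hd, zero_comp]
    | succ p => exact hd (p + 1)
  have ex (p : ℕ) (a : 𝒜) (z : (lin k (cech (nongenπ ξ I) (p + 1))).obj a)
      (hz : ((cechD k (nongenπ ξ I) p).app a).hom z = 0) :
      ∃ y, ((cechD k (nongenπ ξ I) (p + 1)).app a).hom y = z := by
    obtain ⟨σ, hσ⟩ := hS a
    exact ⟨cechH k (p + 1) σ hσ z, (cechD_cechH σ hσ z).trans (by rw [hz, map_zero, sub_zero])⟩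
  have ex' (p : ℕ) : (ShortComplex.mk _ _ (hd' p)).Exact := by
    refine (FunRep.exact_iff _).2 fun a z hz => ?_
    cases p with
    | zero =>
      refine ex 0 a z ?_
      have := (FunRep.mono_iff (linIso k (cechZeroIso (nongenπ ξ I))).hom).1 inferInstance a
      exact this ((lin_nongenι_injective k a (hz.trans (map_zero _).symm)).trans (map_zero _).symm)
    | succ p => exact ex (p + 1) a z hz
  let ε : resObj ξ k I 0 ⟶ QRep L := freeDesc b.e
  have : Epi ε := b.epi_freeDesc
  have h0 : (cechD k (nongenπ ξ I) 0 ≫ (linIso k (cechZeroIso (nongenπ ξ I))).hom ≫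
      Functor.whiskerRight (nongenι A I) (ModuleCat.free k)) ≫ freeDesc b.e = 0 := by
    rw [Category.assoc, Category.assoc, lin_nongenι_freeDesc, comp_zero, comp_zero]
  have hε : resD ξ k I 0 ≫ ε = 0 := h0
  have exε : (ShortComplex.mk _ _ hε).Exact := by
    refine (FunRep.exact_iff _).2 fun a z hz => ?_
    obtain ⟨y, rfl⟩ := exists_lin_nongenι_eq z fun i β hβ => by
      rw [← b.coord_coeff_freeDesc z hβ]
      exact (congrArg (fun z => b.coord i (coeff L β z)) hz).trans
        ((congrArg _ (map_zero _)).trans (map_zero _))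
    obtain ⟨y, rfl⟩ := (FunRep.epi_iff (linIso k (cechZeroIso (nongenπ ξ I))).hom).1
      inferInstance a y
    obtain ⟨σ, hσ⟩ := hS a
    exact ⟨cechH k 0 σ hσ y, congrArg (fun y => ((Functor.whiskerRight (nongenι A I)
      (ModuleCat.free k)).app a).hom (((linIso k (cechZeroIso (nongenπ ξ I))).hom.app a).hom y))
      (cechD_cechH_zero σ hσ y)⟩
  -- The complex of morphisms to the target is zero in positive degrees, so `0` is always a
  -- primitive.
  refine subsingleton_ext_of_resolution n _ (resObj ξ k I) ε (resD ξ k I) hε hd'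
    exε ex' (fun p φ _ => ⟨0, ?_⟩) fun p i _ => ?_
  · exact comp_zero.trans (lin_cech_hom_eq_zero ξ hB hl φ).symm
  · cases p with
    | zero => exact subsingleton_ext_lin_QRep J i (fullFam_isFiberAdditive I)
    | succ p => exact subsingleton_ext_lin_QRep J i (coverFam_cech_isFiberAdditive ξ I p)

end Resolution

end

end

/-! ### Reduction to free and injective modules, and conclusion -/

section

open scoped MonoidAlgebra

open Abelian

universe t t'

variable {𝒜 : Type u} [Category.{v} 𝒜] [Preadditive 𝒜] {k : Type w} [Field k]
  {A B : AddRep.{w} 𝒜}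

/-- The basis of a representation given by a basis of the corresponding module. -/
def freeBasis {L : ModuleCat.{w} k[Aut A]} {I : Type w} (b : Module.Basis I k[Aut A] L) :
    FreeBasis (Rep.ofModuleMonoidAlgebra.obj L) I where
  e i := b i
  coord i :=
    { toFun x := (b.repr x i).coeff 1
      map_add' x y := by
        have h : b.repr (x + y) i = b.repr x i + b.repr y i :=
          congrArg (fun f => f i) (b.repr.map_add x y)
        exact congrArg (fun f => f.coeff 1) h
      map_smul' r x := by
        have h : b.repr (r • x) i = r • b.repr x i :=
          (congrArg (fun f => f i) (b.repr.map_smul (algebraMap k k[Aut A] r) x)).trans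
            (algebraMap_smul _ r (b.repr x i))
        exact congrArg (fun f => f.coeff 1) h }
  coord_self i := by
    change (b.repr (b i) i).coeff 1 = 1
    rw [b.repr_self, Finsupp.single_eq_same]
    simp [MonoidAlgebra.one_def]
  coord_of_ne {i j g} h := by
    classical
    change (b.repr (MonoidAlgebra.single g (1 : k) • b j) i).coeff 1 = 0
    rw [map_smul, b.repr_self, Finsupp.smul_apply, Finsupp.single_apply]
    split_ifs with hij
    · have hg : g ≠ 1 := fun hg => h ⟨hij.symm, hg⟩
      simp [hg]
    · rw [smul_zero]
      rfl
  induction {P} zero add mk x := by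
    change P (show L from x)
    rw [← b.linearCombination_repr (show L from x)]
    induction b.repr (show L from x) using Finsupp.induction_linear with
    | zero => rw [map_zero]; exact zero
    | add f g hf hg => rw [map_add]; exact add _ _ hf hg
    | single i r =>
      rw [Finsupp.linearCombination_single]
      induction r using MonoidAlgebra.induction_linear with
      | zero => rw [zero_smul]; exact zero
      | add f g hf hg => rw [add_smul]; exact add _ _ hf hg
      | single g r =>
        have h : (MonoidAlgebra.single g r : k[Aut A]) • b i =
            algebraMap k k[Aut A] r • (MonoidAlgebra.single g (1 : k) • b i) := by
          rw [smul_smul, ← Algebra.smul_def, MonoidAlgebra.smul_single, smul_eq_mul, mul_one]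
        rw [h]
        exact mk r g i

lemma exists_epi_of_basis {R : Type*} [Ring R] [Small.{w} R] (M : ModuleCat.{w} R) :
    ∃ (L : ModuleCat.{w} R) (_ : Module.Basis M R L) (f : L ⟶ M), Epi f := by
  -- The ring may live in a larger universe than the modules; the free module is built on its small
  -- copy.
  let b : Module.Basis M R (M →₀ Shrink.{w} R) :=
    ⟨Finsupp.mapRange.linearEquiv (Shrink.linearEquiv R R)⟩
  refine ⟨ModuleCat.of R (M →₀ Shrink.{w} R), b, ModuleCat.ofHom (b.constr ℕ id), ?_⟩
  rw [ModuleCat.epi_iff_surjective]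
  exact fun m => ⟨b m, b.constr_basis ℕ id m⟩

variable [HasFiniteBiproducts 𝒜]

lemma IsKTrivial.finite_obj (h𝒜 : IsKTrivial k 𝒜) (hA : IsFiniteObject A) (a : 𝒜) :
    Finite (A.obj.obj a) := by
  have := hA.isNoetherian
  obtain ⟨x, ξ, hξ⟩ := exists_isGenerating A
  exact hξ.finite h𝒜 a

/-- An automorphism is determined by its value at a generating element. Smallness of the group
algebra gives free covers and enough injectives in the universe of the modules. -/
lemma small_monoidAlgebra_aut (k : Type w) [Field k] (hA : IsFiniteObject A) :
    Small.{w} k[Aut A] := by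
  have := hA.isNoetherian
  obtain ⟨x, ξ, hξ⟩ := exists_isGenerating A
  have : Small.{w} (Aut A) :=
    small_of_injective (β := A.obj.obj x) (f := fun g => g • ξ) fun g g' h => hξ.aut_eq h
  exact small_of_injective (MonoidAlgebra.coeffEquiv (R := k) (M := Aut A)).injective

variable [EssentiallySmall.{w} 𝒜] [HasExt.{t} (FunRep k 𝒜)]

lemma subsingleton_ext_of_basis (h𝒜 : IsKTrivial k 𝒜) (hA : IsFiniteObject A)
    (hB : IsFiniteObject B) (hl : objLength A ≤ objLength B) {L : ModuleCat.{w} k[Aut A]}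
    {I : Type w} (b : Module.Basis I k[Aut A] L) (J : ModuleCat.{w} k[Aut B]) [Injective J]
    (n : ℕ) : Subsingleton (Ext ((QFunctor k A).obj L) ((QFunctor k B).obj J) (n + 1)) := by
  have := hA.isNoetherian
  obtain ⟨x, ξ, hξ⟩ := exists_isGenerating A
  have := h𝒜.finite_obj hB
  have := small_monoidAlgebra_aut k hB
  exact (freeBasis b).subsingleton_ext hB hl hξ J n

/-- Vanishing of extensions between the functors attached to non isomorphic finite objects. -/
theorem subsingleton_ext_of_isEmpty_iso (h𝒜 : IsKTrivial k 𝒜) (hA : IsFiniteObject A)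
    (hB : IsFiniteObject B) (hl : objLength A ≤ objLength B) (hAB : IsEmpty (A ≅ B)) (n : ℕ)
    (M : ModuleCat.{w} k[Aut A]) (N : ModuleCat.{w} k[Aut B]) :
    Subsingleton (Ext ((QFunctor k A).obj M) ((QFunctor k B).obj N) n) := by
  have := h𝒜.finite_obj hA
  have := h𝒜.finite_obj hB
  have := small_monoidAlgebra_aut k hA
  have := small_monoidAlgebra_aut k hB
  obtain ⟨_, _⟩ := QFunctor_preserves (k := k) (B := A)
  obtain ⟨_, _⟩ := QFunctor_preserves (k := k) (B := B)
  induction n generalizing M N with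
  | zero => exact (subsingleton_ext_zero_iff _ _).2 (QRep.hom_eq_zero hB hl hAB)
  | succ n ih =>
    let P : InjectivePresentation N := Classical.arbitrary _
    have := P.injective
    obtain ⟨L, b, f, hf⟩ := exists_epi_of_basis M
    have hS : (ShortComplex.mk _ _ (kernel.condition f)).ShortExact :=
      { exact := ShortComplex.exact_kernel f }
    have hT : (ShortComplex.mk _ _ (cokernel.condition P.f)).ShortExact :=
      { exact := ShortComplex.exact_cokernel P.f }
    -- The induction hypothesis is used twice: for the cokernel of `N ⟶ J` on the right, and for the
    -- kernel of `L ⟶ M` on the left.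
    exact subsingleton_ext_X₁_right (hT.map_of_exact (QFunctor k B)) _ n (ih _ _)
      (subsingleton_ext_X₃ (hS.map_of_exact (QFunctor k A)) _ n (ih _ _)
        (subsingleton_ext_of_basis h𝒜 hA hB hl b P.J n))

/-- Here degree zero does not vanish, so the induction starts in degree one: by fullness a morphism
from the kernel part comes from a module map, which extends to the free cover because `J` is
injective. -/
lemma subsingleton_ext_of_injective (h𝒜 : IsKTrivial k 𝒜) (hA : IsFiniteObject A)
    (M J : ModuleCat.{w} k[Aut A]) [Injective J] (n : ℕ) :
    Subsingleton (Ext ((QFunctor k A).obj M) ((QFunctor k A).obj J) (n + 1)) := by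
  have := h𝒜.finite_obj hA
  have := small_monoidAlgebra_aut k hA
  obtain ⟨_, _⟩ := QFunctor_preserves (k := k) (B := A)
  have := QFunctor_full (k := k) hA
  induction n generalizing M with
  | zero =>
    obtain ⟨L, b, f, hf⟩ := exists_epi_of_basis M
    have hS : (ShortComplex.mk _ _ (kernel.condition f)).ShortExact :=
      { exact := ShortComplex.exact_kernel f }
    refine subsingleton_ext_one_X₃ (hS.map_of_exact (QFunctor k A)) _ (fun ψ => ?_)
      (subsingleton_ext_of_basis h𝒜 hA hA le_rfl b J 0)
    obtain ⟨ψ, rfl⟩ := (QFunctor k A).map_surjective ψ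
    refine ⟨(QFunctor k A).map (Injective.factorThru ψ (kernel.ι f)), ?_⟩
    exact ((QFunctor k A).map_comp _ _).symm.trans
      (congrArg _ (Injective.comp_factorThru ψ (kernel.ι f)))
  | succ n ih =>
    obtain ⟨L, b, f, hf⟩ := exists_epi_of_basis M
    have hS : (ShortComplex.mk _ _ (kernel.condition f)).ShortExact :=
      { exact := ShortComplex.exact_kernel f }
    exact subsingleton_ext_X₃ (hS.map_of_exact (QFunctor k A)) _ (n + 1)
      (ih _)
      (subsingleton_ext_of_basis h𝒜 hA hA le_rfl b J (n + 1))

/-- The functor `Q_{A, -}` induces isomorphisms on extension groups. -/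
theorem QFunctor_mapExtAddHom_bijective (h𝒜 : IsKTrivial k 𝒜) (hA : IsFiniteObject A)
    [HasExt.{t'} (ModuleCat.{w} k[Aut A])] [PreservesFiniteLimits (QFunctor k A)]
    [PreservesFiniteColimits (QFunctor k A)] (M N : ModuleCat.{w} k[Aut A]) (n : ℕ) :
    Function.Bijective ((QFunctor k A).mapExtAddHom M N n) := by
  have := hA.isNoetherian
  have := h𝒜.finite_obj hA
  have := small_monoidAlgebra_aut k hA
  have := QFunctor_full (k := k) hA
  have := QFunctor_faithful (k := k) (A := A)
  exact mapExtAddHom_bijective _ (fun X J _ n => subsingleton_ext_of_injective h𝒜 hA X J n) M N n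

end

end GenericRep

end

open CategoryTheory CategoryTheory.Limits GenericRep in
open scoped MonoidAlgebra in
theorem mainTheorem9 (k : Type w) [Field k]
    (𝒜 : Type u) [Category.{v} 𝒜] [Preadditive 𝒜] [HasFiniteBiproducts 𝒜]
    [EssentiallySmall.{w} 𝒜] (h𝒜 : IsKTrivial k 𝒜) :
    (∀ A B : AddRep.{w} 𝒜, IsFiniteObject A → IsFiniteObject B →
      objLength A ≤ objLength B → IsEmpty (A ≅ B) →
      ∀ (M : ModuleCat.{w} k[Aut A]) (N : ModuleCat.{w} k[Aut B]) (n : ℕ),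
        Subsingleton (ExtGroup ((QFunctor k A).obj M) ((QFunctor k B).obj N) n)) ∧
    (∀ A : AddRep.{w} 𝒜, IsFiniteObject A →
      ∃ (_ : PreservesFiniteLimits (QFunctor k A)) (_ : PreservesFiniteColimits (QFunctor k A)),
      ∀ (M N : ModuleCat.{w} k[Aut A]) (n : ℕ),
        Function.Bijective (mapExtGroup (QFunctor k A) M N n)) := by
  let : HasExt.{max (max (w + 1) v u) w v u} (FunRep.{w} k 𝒜) := HasExt.standard _
  refine ⟨fun A B hA hB hl hAB M N n => subsingleton_ext_of_isEmpty_iso h𝒜 hA hB hl hAB n M N,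
    fun A hA => ?_⟩
  have := h𝒜.finite_obj hA
  obtain ⟨h₁, h₂⟩ := QFunctor_preserves (k := k) (B := A)
  let : HasExt.{_} (ModuleCat.{w} k[Aut A]) := HasExt.standard _
  exact ⟨h₁, h₂, fun M N n => QFunctor_mapExtAddHom_bijective h𝒜 hA M N n⟩
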